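/- Theorem 1.2. Let $0<r_1<r_2<\infty$, let $A=\{\zeta\in\mathbb C: r_1\le|\zeta|\le r_2\}$, and for $a\in\mathbb C$, $\rho>0$ let $b\Delta(a,\rho)=\{\zeta:|\zeta-a|=\rho\}$; this circle surrounds the origin if $|a|<\rho$. Let $f:A\to\mathbb C$ be Hölder continuous and suppose that $$\frac1{2\pi}\int_0^{2\pi}f(a+\rho e^{i\theta})\,d\theta=0$$ for every circle $b\Delta(a,\rho)\subset A$ which surrounds the origin. Put $$\Lambda^+_{a,\rho}=\{(z,w)\in\mathbb C^2:(z-a)(w-\bar a)=\rho^2,\ 0<|z-a|<\rho\},\qquad \Lambda^-_{a,\rho}=\{(z,w)\in\mathbb C^2:(z-a)(w-\bar a)=\rho^2,\ |z-a|>\rho\},$$ and let $\Omega^{\pm}(A)\subset\mathbb C^2$ be the union of all $\Lambda^{\pm}_{a,\rho}$ such that $b\Delta(a,\rho)\subset\operatorname{Int}A$ surrounds the origin. (The sets $\Omega^\pm(A)$ are open, and $(z,\bar z)$ lies in the closure of both for every $z\in A$.) Then there are a bounded continuous function $G^+$ on the closure $\Omega^+(A)\cup b\Omega^+(A)$ which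 is holomorphic on $\Omega^+(A)$, and a bounded continuous function $G^-$ on the closure $\Omega^-(A)\cup b\Omega^-(A)$ which is holomorphic on $\Omega^-(A)$, such that $$f(z)=\frac1{\bar z}\,G^+(z,\bar z)+\frac1z\,G^-(z,\bar z)\qquad(z\in A).$$ -/

import Mathlib

open scoped ComplexConjugate NNReal

/-- The closed annulus `{ζ : r₁ ≤ |ζ| ≤ r₂}` in the plane. -/
def closedAnnulus (r₁ r₂ : ℝ) : Set ℂ :=
  {ζ : ℂ | r₁ ≤ ‖ζ‖ ∧ ‖ζ‖ ≤ r₂}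

/-- The circle with centre `a` and radius `ρ` surrounds the origin: the origin lies in the open
disc that it bounds (in particular `0 < ρ`). -/
def CircleSurroundsOrigin (a : ℂ) (ρ : ℝ) : Prop :=
  (0 : ℂ) ∈ Metric.ball a ρ

/-- `f` is Hölder continuous on `s`, with some exponent in `(0, 1]`. -/
def IsHolderContinuousOn (f : ℂ → ℂ) (s : Set ℂ) : Prop :=
  ∃ C α : ℝ≥0, 0 < α ∧ α ≤ 1 ∧ HolderOnWith C α f s

/-- The part `Λ⁺` of the complex curve `(z - a) (w - ā) = ρ²` where `0 < |z - a| < ρ`. -/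
def lambdaPlus (a : ℂ) (ρ : ℝ) : Set (ℂ × ℂ) :=
  {p : ℂ × ℂ | (p.1 - a) * (p.2 - conj a) = (ρ : ℂ) ^ 2 ∧ 0 < ‖p.1 - a‖ ∧ ‖p.1 - a‖ < ρ}

/-- The part `Λ⁻` of the complex curve `(z - a) (w - ā) = ρ²` where `ρ < |z - a|`. -/
def lambdaMinus (a : ℂ) (ρ : ℝ) : Set (ℂ × ℂ) :=
  {p : ℂ × ℂ | (p.1 - a) * (p.2 - conj a) = (ρ : ℂ) ^ 2 ∧ ρ < ‖p.1 - a‖}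

/-- `Ω⁺(A)`: the union of the curves `Λ⁺` over all circles in the interior of `A` that surround
the origin. -/
def omegaPlus (A : Set ℂ) : Set (ℂ × ℂ) :=
  {p : ℂ × ℂ | ∃ (a : ℂ) (ρ : ℝ), Metric.sphere a ρ ⊆ interior A ∧ CircleSurroundsOrigin a ρ ∧
    p ∈ lambdaPlus a ρ}

/-- `Ω⁻(A)`: the union of the curves `Λ⁻` over all circles in the interior of `A` that surround
the origin. -/
def omegaMinus (A : Set ℂ) : Set (ℂ × ℂ) :=
  {p : ℂ × ℂ | ∃ (a : ℂ) (ρ : ℝ), Metric.sphere a ρ ⊆ interior A ∧ CircleSurroundsOrigin a ρ ∧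
    p ∈ lambdaMinus a ρ}

/-- `G` is a bounded continuous function on the closure `Ω ∪ bΩ` of the open set `Ω ⊆ ℂ²`,
holomorphic on `Ω`. (Only the values of `G` on the closure of `Ω` matter.) -/
def IsBoundedContHolo (G : ℂ × ℂ → ℂ) (Ω : Set (ℂ × ℂ)) : Prop :=
  ContinuousOn G (closure Ω) ∧ (∃ M : ℝ, ∀ p ∈ closure Ω, ‖G p‖ ≤ M) ∧ DifferentiableOn ℂ G Ω

/-!
On a circle with centre `a` and radius `ρ` one has `ζ̄ = ā + ρ² / (ζ - a)`, and the zero of this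
function of `ζ` lies outside the closed disc when the circle surrounds the origin. Hence
`ζ^k / ζ̄^(l+1)` extends from every such circle holomorphically to the disc, with the value zero at
the centre, and has average zero; so has its conjugate. The functions
`u z = G (z, z̄) / z̄ + H (z̄, z) / z`, with `G` and `H` in the span of the monomials `z^k w⁻¹^l`,
therefore satisfy the hypothesis and the conclusion of the theorem: `G` itself is `Gp`, and `H` with
its arguments exchanged is `Gm`. The proof shows that these functions approximate `f` well enough.

*Fourier components.* The component `f_n` of `f` with respect to rotations still has vanishing
averages. For `n ≥ 0` it is `κ(log |z|²) / z̄ⁿ`. The operator `∂` preserves the vanishing of the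
averages and sends such a function to `(e^{-y} κ')(log |z|²) / z̄ⁿ⁻¹`, so by induction on `n` the
profile `κ` is a polynomial of degree less than `n` in `e^y = |z|²`
(`exists_polynomial_of_hasZeroCircleAverages`), that is, `f_n` has the form `G (z, z̄) / z̄`.
Negative indices reduce to this case by conjugation.

*Approximation.* The averages of the rotated copies of `f` against the kernels `(1 + cos φ)ᴺ` are
finite combinations of the `f_n`. They converge uniformly to `f` and satisfy the Hölder bound of `f`
(`exists_decomposable_tendstoUniformlyOn`).

*Estimate.* On the curve `Λ⁺` of a circle, `G` is the Cauchy integral of `ζ̄ u(ζ)` over the circle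
(`IsDecomposable.circleAverage_eq`). It is therefore bounded by the supremum and the Hölder constant
of `u` for any positive exponent, uniformly in the circle (`exists_norm_le_of_isDecomposable`). With
half the exponent of `f` the differences of the approximants are small in this norm, so their parts
`G` converge uniformly on `Ω⁺` and its closure (`uniformCauchySeqOn_omegaPlus`). The parts `H` are
treated by passing to `z ↦ f z̄`, which exchanges `Ω⁺` and `Ω⁻`.
-/

open Filter Topology

/-! ### Circle averages and profiles of functions of a fixed rotation type -/

/-- All circles around the origin that lie in the open annulus `R₁ < |z| < R₂` give `g` the
average zero. -/
def HasZeroCircleAverages (g : ℂ → ℂ) (R₁ R₂ : ℝ) : Prop :=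
  ∀ (a : ℂ) (ρ : ℝ), R₁ < ρ - ‖a‖ → ρ + ‖a‖ < R₂ → Real.circleAverage g a ρ = 0

theorem sub_norm_le_norm_circleMap (a : ℂ) {ρ : ℝ} (hρ : 0 ≤ ρ) (θ : ℝ) :
    ρ - ‖a‖ ≤ ‖circleMap a ρ θ‖ := by
  have h := norm_sub_le (circleMap a ρ θ) a
  rw [circleMap_sub_center, norm_circleMap_zero, abs_of_nonneg hρ] at h
  linarith

theorem norm_circleMap_le_add (a : ℂ) {ρ : ℝ} (hρ : 0 ≤ ρ) (θ : ℝ) :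
    ‖circleMap a ρ θ‖ ≤ ρ + ‖a‖ := by
  have h := norm_add_le (circleMap a ρ θ - a) a
  rw [sub_add_cancel, circleMap_sub_center, norm_circleMap_zero, abs_of_nonneg hρ] at h
  exact h

theorem circleMap_ne_zero_of_norm_lt {a : ℂ} {ρ : ℝ} (h : ‖a‖ < ρ) (θ : ℝ) :
    circleMap a ρ θ ≠ 0 := by
  have := sub_norm_le_norm_circleMap a ((norm_nonneg a).trans h.le) θ
  exact norm_pos_iff.1 (by linarith)

theorem circleAverage_comp_mul_left (g : ℂ → ℂ) (c : ℝ) (a : ℂ) (ρ : ℝ) :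
    Real.circleAverage (fun z => g (c * z)) a ρ = Real.circleAverage g (c * a) (c * ρ) := by
  simp only [Real.circleAverage_def, circleMap]
  congr 2
  ext θ
  push_cast
  ring_nf

/-- Fubini's theorem for the circle averages of a continuous family of functions. -/
theorem circleAverage_intervalIntegral_swap {h : ℝ → ℂ → ℂ} {a : ℂ} {ρ s t : ℝ}
    (hc : Continuous fun q : ℝ × ℝ => h q.1 (circleMap a ρ q.2)) :
    Real.circleAverage (fun z => ∫ x in s..t, h x z) a ρ =
      ∫ x in s..t, Real.circleAverage (h x) a ρ := by
  simp only [Real.circleAverage_def]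
  rw [intervalIntegral.integral_smul]
  congr 1
  refine (MeasureTheory.intervalIntegral_intervalIntegral_swap ?_).symm
  exact (hc.continuousOn.integrableOn_compact
    ((isCompact_uIcc (a := s) (b := t)).prod (isCompact_uIcc (a := 0)
      (b := 2 * Real.pi)))).mono_set (Set.prod_mono Set.uIoc_subset_uIcc Set.uIoc_subset_uIcc)

/-- Differentiation under the integral sign: if the averages of `g` over a circle around the
origin and over its small translates in the direction `v` all vanish, so does the average of the
directional derivative of `g`. -/
theorem circleAverage_eq_zero_of_hasDerivAt {g D : ℂ → ℂ} {v a : ℂ} {ρ : ℝ}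
    (hg : ContinuousOn g {0}ᶜ) (hD : ContinuousOn D {0}ᶜ)
    (hgD : ∀ z ≠ 0, HasDerivAt (fun t : ℝ => g (z + t * v)) (D z) 0) (ha : ‖a‖ < ρ)
    (h0 : ∀ᶠ t : ℝ in 𝓝 0, Real.circleAverage g (a + t * v) ρ = 0) :
    Real.circleAverage D a ρ = 0 := by
  have hcont : Continuous fun t : ℝ => ‖a + t * v‖ := by fun_prop
  have hlt : ∀ᶠ t : ℝ in 𝓝 0, ‖a + t * v‖ < ρ :=
    hcont.continuousAt.eventually_lt continuousAt_const (by simpa using ha)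
  obtain ⟨ε, hε, hball⟩ := Metric.eventually_nhds_iff_ball.1 hlt
  have hshift : ∀ t θ : ℝ, circleMap a ρ θ + t * v = circleMap (a + t * v) ρ θ := by
    intro t θ; simp only [circleMap]; ring
  have hne : ∀ t ∈ Metric.ball (0 : ℝ) ε, ∀ θ : ℝ, circleMap a ρ θ + t * v ≠ 0 := by
    intro t ht θ
    rw [hshift]
    exact circleMap_ne_zero_of_norm_lt (hball t ht) θ
  have hpath : Continuous fun q : ℝ × ℝ => circleMap a ρ q.2 + q.1 * v := by
    simp only [circleMap]; fun_prop
  have hslice : ∀ G : ℂ → ℂ, ContinuousOn G {0}ᶜ → ∀ t ∈ Metric.ball (0 : ℝ) ε,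
      Continuous fun θ : ℝ => G (circleMap a ρ θ + t * v) := by
    intro G hG t ht
    exact hG.comp_continuous (hpath.comp (by fun_prop : Continuous fun θ : ℝ => (t, θ)))
      fun θ => hne t ht θ
  have hsub : Metric.closedBall (0 : ℝ) (ε / 2) ⊆ Metric.ball 0 ε :=
    Metric.closedBall_subset_ball (by linarith)
  obtain ⟨M, hM⟩ := ((isCompact_closedBall (0 : ℝ) (ε / 2)).prod
    (isCompact_Icc (a := (0 : ℝ)) (b := 2 * Real.pi))).exists_bound_of_continuousOn
      (f := fun q : ℝ × ℝ => D (circleMap a ρ q.2 + q.1 * v))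
      (hD.comp hpath.continuousOn fun q hq => hne q.1 (hsub hq.1) q.2)
  have hmem : (0 : ℝ) ∈ Metric.ball (0 : ℝ) ε := Metric.mem_ball_self hε
  have key := (intervalIntegral.hasDerivAt_integral_of_dominated_loc_of_deriv_le
    (μ := MeasureTheory.volume) (𝕜 := ℝ) (a := 0) (b := 2 * Real.pi) (x₀ := 0)
    (F := fun t θ => g (circleMap a ρ θ + t * v))
    (F' := fun t θ => D (circleMap a ρ θ + t * v)) (bound := fun _ => M)
    (Metric.closedBall_mem_nhds (0 : ℝ) (half_pos hε)) ?_ ?_ ?_ ?_ ?_ ?_).2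
  · have h2 : (fun t : ℝ => ∫ θ in (0 : ℝ)..2 * Real.pi, g (circleMap a ρ θ + t * v))
        =ᶠ[𝓝 0] fun _ => 0 := by
      filter_upwards [h0] with t ht
      simp only [hshift]
      rw [Real.circleAverage_def] at ht
      exact (smul_eq_zero.1 ht).resolve_left (by positivity)
    have h3 := key.unique ((hasDerivAt_const (0 : ℝ) (0 : ℂ)).congr_of_eventuallyEq h2)
    simp only [Complex.ofReal_zero, zero_mul, add_zero] at h3
    rw [Real.circleAverage_def, h3, smul_zero]
  · filter_upwards [Metric.ball_mem_nhds (0 : ℝ) hε] with t ht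
    exact (hslice g hg t ht).aestronglyMeasurable
  · exact (hslice g hg 0 hmem).intervalIntegrable _ _
  · exact (hslice D hD 0 hmem).aestronglyMeasurable
  · refine .of_forall fun θ hθ t ht => hM (t, θ) ⟨ht, ?_⟩
    rw [Set.uIoc_of_le Real.two_pi_pos.le] at hθ
    exact Set.Ioc_subset_Icc_self hθ
  · exact intervalIntegrable_const
  · refine .of_forall fun θ _ t ht => ?_
    have h1 := hgD _ (hne t (hsub ht) θ)
    have h2 := HasDerivAt.comp_sub_const t t (by simpa using h1)
    refine h2.congr_of_eventuallyEq (.of_forall fun s => ?_)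
    simp only
    congr 1
    push_cast
    ring

/-- The function `κ(log |z|²) / z̄ⁿ`. Every function on an annulus that satisfies
`g (e^{iφ} z) = e^{inφ} g z` has this form; the logarithmic variable makes the profile `κ` a
function on the whole real line. -/
noncomputable def radialTwist (n : ℕ) (κ : ℝ → ℂ) (z : ℂ) : ℂ :=
  κ (2 * Real.log ‖z‖) * (conj z ^ n)⁻¹

theorem continuousOn_radialTwist (n : ℕ) {κ : ℝ → ℂ} (hκ : Continuous κ) :
    ContinuousOn (radialTwist n κ) {0}ᶜ := by
  intro z hz
  have hz : z ≠ 0 := hz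
  refine ContinuousAt.continuousWithinAt ?_
  refine ContinuousAt.mul (hκ.continuousAt.comp ?_) (ContinuousAt.inv₀ ?_ ?_)
  · exact continuousAt_const.mul (continuous_norm.continuousAt.log (norm_ne_zero_iff.2 hz))
  · exact (Complex.continuous_conj.pow n).continuousAt
  · simpa using fun h : z = 0 => absurd h hz

theorem radialTwist_comp_add (n : ℕ) (κ : ℝ → ℂ) (s : ℝ) {z : ℂ} (hz : z ≠ 0) :
    radialTwist n (fun y => κ (y + s)) z =
      ((Real.exp (s / 2) : ℝ) : ℂ) ^ n * radialTwist n κ ((Real.exp (s / 2) : ℝ) * z) := by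
  have h1 : 2 * Real.log ‖((Real.exp (s / 2) : ℝ) : ℂ) * z‖ = 2 * Real.log ‖z‖ + s := by
    rw [norm_mul, Complex.norm_real, Real.norm_eq_abs, Real.abs_exp,
      Real.log_mul (Real.exp_pos _).ne' (norm_ne_zero_iff.2 hz), Real.log_exp]
    ring
  have h2 : ((Real.exp (s / 2) : ℝ) : ℂ) ≠ 0 := by exact_mod_cast (Real.exp_pos _).ne'
  have h3 : conj z ≠ 0 := by simpa using hz
  simp only [radialTwist]
  rw [h1, map_mul, Complex.conj_ofReal, mul_pow]
  field_simp

/-- The derivative of `radialTwist n κ` in the direction `v`, for a profile `κ` with derivative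
`κ'`. -/
noncomputable def radialTwistDeriv (n : ℕ) (κ κ' : ℝ → ℂ) (v z : ℂ) : ℂ :=
  κ' (2 * Real.log ‖z‖) * (v / z + conj v / conj z) * (conj z ^ n)⁻¹ -
    κ (2 * Real.log ‖z‖) * (n * (conj v / conj z) * (conj z ^ n)⁻¹)

theorem hasDerivAt_radialTwist (n : ℕ) {κ κ' : ℝ → ℂ} (hκ : ∀ y, HasDerivAt κ (κ' y) y)
    (v : ℂ) {z : ℂ} (hz : z ≠ 0) :
    HasDerivAt (fun t : ℝ => radialTwist n κ (z + t * v)) (radialTwistDeriv n κ κ' v z) 0 := by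
  have hzc : conj z ≠ 0 := by simpa using hz
  have hline : HasDerivAt (fun t : ℝ => z + t * v) v 0 := by
    simpa using ((Complex.ofRealCLM.hasDerivAt (x := (0 : ℝ))).mul_const v).const_add z
  have hconj : HasDerivAt (fun t : ℝ => conj (z + t * v)) (conj v) 0 := by
    simpa using ((Complex.ofRealCLM.hasDerivAt (x := (0 : ℝ))).mul_const (conj v)).const_add
      (conj z)
  have hsq : HasDerivAt (fun t : ℝ => Complex.normSq (z + t * v))
      (2 * (z * conj v).re) 0 := by
    have h1 := ((hasDerivAt_id (0 : ℝ)).mul_const v.re).const_add z.re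
    have h2 := ((hasDerivAt_id (0 : ℝ)).mul_const v.im).const_add z.im
    have h3 := (h1.mul h1).add (h2.mul h2)
    simp only [id, zero_mul, add_zero, one_mul] at h3
    refine (h3.congr_of_eventuallyEq (.of_forall fun t => ?_)).congr_deriv ?_
    · simp [Complex.normSq_apply]
    · simp; ring
  have hlog : HasDerivAt (fun t : ℝ => 2 * Real.log ‖z + t * v‖)
      (2 * (z * conj v).re / Complex.normSq z) 0 := by
    have h1 := hsq.log (by simpa using hz)
    simp only [Complex.ofReal_zero, zero_mul, add_zero] at h1
    refine h1.congr_of_eventuallyEq (.of_forall fun t => ?_)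
    simp only [Complex.normSq_eq_norm_sq, Real.log_pow]
    norm_num
  have hfirst : HasDerivAt (fun t : ℝ => κ (2 * Real.log ‖z + t * v‖))
      ((2 * (z * conj v).re / Complex.normSq z : ℝ) • κ' (2 * Real.log ‖z‖)) 0 := by
    have h1 := hκ (2 * Real.log ‖z + ((0 : ℝ) : ℂ) * v‖)
    have h2 := h1.scomp (0 : ℝ) hlog
    simpa [Function.comp_def] using h2
  have hsecond := (hconj.pow n).inv (by simpa using fun h : z = 0 => absurd h hz)
  have h := hfirst.mul hsecond
  refine h.congr_deriv ?_
  have e1 : ((2 * (z * conj v).re / Complex.normSq z : ℝ) : ℂ) = v / z + conj v / conj z := by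
    push_cast
    rw [← Complex.mul_conj]
    have : (2 : ℂ) * ((z * conj v).re : ℂ) = z * conj v + conj z * v := by
      have := Complex.add_conj (z * conj v)
      rw [map_mul, Complex.conj_conj] at this
      push_cast at this
      exact this.symm
    rw [this]
    field_simp
    exact add_comm _ _
  simp only [Complex.ofReal_zero, zero_mul, add_zero, Complex.real_smul, radialTwistDeriv]
  rw [e1]
  rcases n with _ | n
  · simp [mul_comm]
  · simp only [Nat.add_sub_cancel, Pi.pow_apply, Complex.ofReal_zero, zero_mul, add_zero,
      Pi.inv_apply]
    field_simp
    push_cast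
    ring

theorem continuousOn_radialTwistDeriv (n : ℕ) {κ κ' : ℝ → ℂ} (hκ : Continuous κ)
    (hκ' : Continuous κ') (v : ℂ) : ContinuousOn (radialTwistDeriv n κ κ' v) {0}ᶜ := by
  have hid : ContinuousOn (fun z : ℂ => v / z) {0}ᶜ :=
    continuousOn_const.div continuousOn_id fun z hz => hz
  have hconj : ContinuousOn (fun z : ℂ => conj v / conj z) {0}ᶜ :=
    continuousOn_const.div Complex.continuous_conj.continuousOn fun z hz => by simpa using hz
  have h1 := (continuousOn_radialTwist n hκ').mul (hid.add hconj)
  have h2 := (continuousOn_radialTwist n hκ).mul (hconj.const_smul (n : ℂ))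
  refine (h1.sub h2).congr fun z _ => ?_
  simp only [radialTwistDeriv, radialTwist, Pi.sub_apply, Pi.mul_apply, Pi.add_apply,
    Pi.smul_apply, smul_eq_mul]
  ring

/-- Up to the factor `2`, the operator `∂ = (∂ₓ - i ∂ᵧ) / 2` sends `κ(log |z|²) / z̄ⁿ⁺¹` to
`(e^{-y} κ'(y))(log |z|²) / z̄ⁿ`: it commutes with the division by a power of `z̄`. -/
theorem radialTwistDeriv_one_sub (n : ℕ) (κ κ' : ℝ → ℂ) {z : ℂ} (hz : z ≠ 0) :
    radialTwistDeriv (n + 1) κ κ' 1 z - Complex.I * radialTwistDeriv (n + 1) κ κ' Complex.I z =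
      2 * radialTwist n (fun y => (Real.exp (-y) : ℝ) * κ' y) z := by
  have hzc : conj z ≠ 0 := by simpa using hz
  have e : ((Real.exp (-(2 * Real.log ‖z‖)) : ℝ) : ℂ) = (z * conj z)⁻¹ := by
    rw [Real.exp_neg, two_mul, Real.exp_add, Real.exp_log (norm_pos_iff.2 hz), Complex.mul_conj,
      Complex.normSq_eq_norm_sq]
    push_cast
    rw [sq]
  simp only [radialTwistDeriv, radialTwist, e, map_one, Complex.conj_I]
  field_simp
  ring_nf
  simp only [Complex.I_sq]
  ring

/-! ### Rigidity of the profiles -/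

theorem circleIntegrable_of_continuousOn_compl_zero {g : ℂ → ℂ} (hg : ContinuousOn g {0}ᶜ)
    {a : ℂ} {ρ : ℝ} (ha : ‖a‖ < ρ) : CircleIntegrable g a ρ :=
  (hg.comp_continuous (continuous_circleMap a ρ)
    fun θ => circleMap_ne_zero_of_norm_lt ha θ).intervalIntegrable _ _

/-- If the circle averages of `κ(log |z|²) / z̄ⁿ⁺¹` vanish, so do those of its `∂`-derivative. -/
theorem HasZeroCircleAverages.deriv_radialTwist {n : ℕ} {κ κ' : ℝ → ℂ}
    (hκ : ∀ y, HasDerivAt κ (κ' y) y) (hκ' : Continuous κ') {R₁ R₂ : ℝ} (hR₁ : 0 ≤ R₁)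
    (h : HasZeroCircleAverages (radialTwist (n + 1) κ) R₁ R₂) :
    HasZeroCircleAverages (radialTwist n fun y => (Real.exp (-y) : ℝ) * κ' y) R₁ R₂ := by
  intro a ρ h1 h2
  have ha : ‖a‖ < ρ := by linarith
  have hc : Continuous κ := continuous_iff_continuousAt.2 fun y => (hκ y).continuousAt
  have hv : ∀ v : ℂ, Real.circleAverage (radialTwistDeriv (n + 1) κ κ' v) a ρ = 0 := by
    intro v
    have hcont : Continuous fun t : ℝ => ‖a + t * v‖ := by fun_prop
    refine circleAverage_eq_zero_of_hasDerivAt (continuousOn_radialTwist (n + 1) hc)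
      (continuousOn_radialTwistDeriv (n + 1) hc hκ' v)
      (fun z hz => hasDerivAt_radialTwist (n + 1) hκ v hz) ha ?_
    have e1 : ∀ᶠ t : ℝ in 𝓝 0, ‖a + t * v‖ < ρ - R₁ :=
      hcont.continuousAt.eventually_lt continuousAt_const (by simp; linarith)
    have e2 : ∀ᶠ t : ℝ in 𝓝 0, ‖a + t * v‖ < R₂ - ρ :=
      hcont.continuousAt.eventually_lt continuousAt_const (by simp; linarith)
    filter_upwards [e1, e2] with t ht1 ht2
    exact h _ _ (by linarith) (by linarith)
  have hint : ∀ v : ℂ, CircleIntegrable (radialTwistDeriv (n + 1) κ κ' v) a ρ := fun v =>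
    circleIntegrable_of_continuousOn_compl_zero (continuousOn_radialTwistDeriv (n + 1) hc hκ' v) ha
  have hI := (hint Complex.I).const_fun_smul (a := Complex.I)
  have h3 := Real.circleAverage_fun_sub (hint 1) hI
  rw [Real.circleAverage_fun_smul, hv, hv, smul_zero, sub_zero] at h3
  have h4 : Real.circleAverage
      (fun z => (2 : ℂ) • radialTwist n (fun y => (Real.exp (-y) : ℝ) * κ' y) z) a ρ = 0 := by
    rw [← h3]
    refine Real.circleAverage_congr_sphere fun z hz => ?_
    have hz0 : z ≠ 0 := by
      rintro rfl
      rw [abs_of_pos ((norm_nonneg a).trans_lt ha)] at hz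
      simp at hz
      linarith
    simp only [smul_eq_mul]
    exact (radialTwistDeriv_one_sub n κ κ' hz0).symm
  rw [Real.circleAverage_fun_smul] at h4
  exact (smul_eq_zero.1 h4).resolve_left two_ne_zero

/-- Averaging the profile over an interval of length `δ` averages the function over dilations, so
it keeps the vanishing of the circle averages on a smaller annulus. -/
theorem HasZeroCircleAverages.integral_radialTwist {n : ℕ} {κ : ℝ → ℂ} (hκ : Continuous κ)
    {y₁ y₂ δ : ℝ} (hδ : 0 ≤ δ)
    (h : HasZeroCircleAverages (radialTwist n κ) (Real.exp (y₁ / 2)) (Real.exp (y₂ / 2))) :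
    HasZeroCircleAverages (radialTwist n fun y => ∫ s in (0 : ℝ)..δ, κ (y + s))
      (Real.exp (y₁ / 2)) (Real.exp ((y₂ - δ) / 2)) := by
  intro a ρ h1 h2
  have ha : ‖a‖ < ρ := by linarith [Real.exp_pos (y₁ / 2)]
  have hne := circleMap_ne_zero_of_norm_lt ha
  have e : radialTwist n (fun y => ∫ s in (0 : ℝ)..δ, κ (y + s)) =
      fun z => ∫ s in (0 : ℝ)..δ, radialTwist n (fun y => κ (y + s)) z := by
    ext z
    simp only [radialTwist]
    rw [intervalIntegral.integral_mul_const]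
  rw [e, circleAverage_intervalIntegral_swap]
  · refine (intervalIntegral.integral_congr fun s hs => ?_).trans intervalIntegral.integral_zero
    rw [Set.uIcc_of_le hδ] at hs
    have e2 : Real.circleAverage (radialTwist n fun y => κ (y + s)) a ρ = Real.circleAverage
        (fun z => ((Real.exp (s / 2) : ℝ) : ℂ) ^ n •
          radialTwist n κ ((Real.exp (s / 2) : ℝ) * z)) a ρ := by
      simp only [Real.circleAverage_def]
      congr 2
      ext θ
      exact radialTwist_comp_add n κ s (hne θ)
    have hc1 : 1 ≤ Real.exp (s / 2) := Real.one_le_exp (by linarith [hs.1])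
    have hc2 : Real.exp (s / 2) * Real.exp ((y₂ - δ) / 2) ≤ Real.exp (y₂ / 2) := by
      rw [← Real.exp_add]
      exact Real.exp_le_exp.2 (by linarith [hs.2])
    have hnorm : ‖((Real.exp (s / 2) : ℝ) : ℂ) * a‖ = Real.exp (s / 2) * ‖a‖ := by
      rw [norm_mul, Complex.norm_real, Real.norm_eq_abs, Real.abs_exp]
    rw [e2, Real.circleAverage_fun_smul, circleAverage_comp_mul_left, h, smul_zero]
    · rw [hnorm]
      nlinarith [Real.exp_pos (y₁ / 2)]
    · rw [hnorm]
      nlinarith [Real.exp_pos (s / 2)]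
  · simp only [radialTwist]
    have hcirc : Continuous fun q : ℝ × ℝ => circleMap a ρ q.2 := by
      simp only [circleMap]; fun_prop
    refine Continuous.mul (hκ.comp ?_) (Continuous.inv₀ ?_ ?_)
    · exact (continuous_const.mul (hcirc.norm.log fun q => norm_ne_zero_iff.2 (hne q.2))).add
        continuous_fst
    · exact (Complex.continuous_conj.comp hcirc).pow n
    · intro q
      exact pow_ne_zero n (by simpa using hne q.2)

theorem hasDerivAt_integral_add {κ : ℝ → ℂ} (hκ : Continuous κ) (δ y : ℝ) :
    HasDerivAt (fun y => ∫ s in (0 : ℝ)..δ, κ (y + s)) (κ (y + δ) - κ y) y := by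
  have hK : ∀ x, HasDerivAt (fun x => ∫ s in (0 : ℝ)..x, κ s) (κ x) x := fun x =>
    intervalIntegral.integral_hasDerivAt_right (hκ.intervalIntegrable _ _)
      hκ.aestronglyMeasurable.stronglyMeasurableAtFilter hκ.continuousAt
  have h := (HasDerivAt.comp_add_const y δ (hK (y + δ))).sub (hK y)
  refine h.congr_of_eventuallyEq (.of_forall fun x => ?_)
  simp only [Pi.sub_apply]
  rw [intervalIntegral.integral_comp_add_left κ x, add_zero,
    intervalIntegral.integral_interval_sub_left (hκ.intervalIntegrable _ _)
      (hκ.intervalIntegrable _ _)]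

theorem tendsto_inv_smul_integral_add {κ : ℝ → ℂ} (hκ : Continuous κ) (y : ℝ) :
    Tendsto (fun δ : ℝ => (δ : ℂ)⁻¹ * ∫ s in (0 : ℝ)..δ, κ (y + s)) (𝓝[>] 0) (𝓝 (κ y)) := by
  have hc : Continuous fun s => κ (y + s) := by fun_prop
  have h : HasDerivAt (fun x => ∫ s in (0 : ℝ)..x, κ (y + s)) (κ (y + 0)) 0 :=
    intervalIntegral.integral_hasDerivAt_right (hc.intervalIntegrable _ _)
      hc.aestronglyMeasurable.stronglyMeasurableAtFilter hc.continuousAt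
  have h2 := (hasDerivWithinAt_iff_tendsto_slope' (by simp)).1
    (h.hasDerivWithinAt (s := Set.Ioi 0))
  rw [add_zero] at h2
  refine h2.congr fun δ => ?_
  simp [slope_def_module]

theorem Polynomial.exists_derivative_eq {n : ℕ} {p : Polynomial ℂ} (hp : p.degree < n) :
    ∃ q : Polynomial ℂ, q.degree < (n + 1 : ℕ) ∧ Polynomial.derivative q = p := by
  refine ⟨∑ j ∈ Finset.range n, Polynomial.monomial (j + 1) (p.coeff j / (j + 1)), ?_, ?_⟩
  · refine (Polynomial.degree_sum_le _ _).trans_lt ((Finset.sup_lt_iff ?_).2 fun j hj => ?_)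
    · exact WithBot.bot_lt_coe _
    · refine (Polynomial.degree_monomial_le _ _).trans_lt ?_
      have := Finset.mem_range.1 hj
      exact_mod_cast (by omega : j + 1 < n + 1)
  · rw [Polynomial.derivative_sum]
    ext k
    simp only [Polynomial.derivative_monomial, Polynomial.finsetSum_coeff, Nat.add_sub_cancel,
      Polynomial.coeff_monomial, Finset.sum_ite_eq', Finset.mem_range]
    have : (k : ℂ) + 1 ≠ 0 := by exact_mod_cast Nat.succ_ne_zero k
    split_ifs with hk
    · push_cast
      field_simp
    · refine (Polynomial.coeff_eq_zero_of_degree_lt (hp.trans_le ?_)).symm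
      exact_mod_cast not_lt.1 hk

/-- A continuous profile `κ` for which the circle averages of `κ(log |z|²) / z̄ⁿ` vanish is a
polynomial of degree less than `n` in `e^y = |z|²`. -/
theorem exists_polynomial_of_hasZeroCircleAverages (n : ℕ) {κ : ℝ → ℂ} (hκ : Continuous κ)
    {y₁ y₂ : ℝ}
    (h : HasZeroCircleAverages (radialTwist n κ) (Real.exp (y₁ / 2)) (Real.exp (y₂ / 2))) :
    ∃ p : Polynomial ℂ, p.degree < n ∧
      ∀ y ∈ Set.Ioo y₁ y₂, κ y = p.eval ((Real.exp y : ℝ) : ℂ) := by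
  induction n generalizing κ y₁ y₂ with
  | zero =>
    refine ⟨0, by simp, fun y hy => ?_⟩
    have h1 := h 0 (Real.exp (y / 2)) (by simp; linarith [hy.1]) (by simp; linarith [hy.2])
    rw [Real.circleAverage_const_on_circle (a := κ y)] at h1
    · simpa using h1
    · intro z hz
      have : ‖z‖ = Real.exp (y / 2) := by simpa using hz
      simp only [radialTwist, this, Real.log_exp, pow_zero, inv_one, mul_one]
      congr 1
      ring
  | succ n ih =>
    -- The mean of `κ` over `[y, y + δ]` is continuously differentiable, and the induction
    -- hypothesis applies to its derivative.
    have hδ : ∀ δ > 0, ∃ p : Polynomial ℂ, p.degree < (n + 1 : ℕ) ∧ ∀ y ∈ Set.Ioo y₁ (y₂ - δ),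
        ∫ s in (0 : ℝ)..δ, κ (y + s) = p.eval ((Real.exp y : ℝ) : ℂ) := by
      intro δ hδ
      obtain ⟨p, hp, hpe⟩ := ih (κ := fun y => (Real.exp (-y) : ℝ) * (κ (y + δ) - κ y))
        (by fun_prop) ((h.integral_radialTwist hκ hδ.le).deriv_radialTwist
          (hasDerivAt_integral_add hκ δ) (by fun_prop) (Real.exp_pos _).le)
      obtain ⟨q, hq, hqp⟩ := Polynomial.exists_derivative_eq hp
      have hder : ∀ y ∈ Set.Ioo y₁ (y₂ - δ), HasDerivAt
          (fun y => (∫ s in (0 : ℝ)..δ, κ (y + s)) - q.eval ((Real.exp y : ℝ) : ℂ)) 0 y := by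
        intro y hy
        have h1 : HasDerivAt (fun y : ℝ => ((Real.exp y : ℝ) : ℂ)) ((Real.exp y : ℝ) : ℂ) y :=
          (Real.hasDerivAt_exp y).ofReal_comp
        have h2 := (q.hasDerivAt ((Real.exp y : ℝ) : ℂ)).comp y h1
        refine ((hasDerivAt_integral_add hκ δ y).sub h2).congr_deriv ?_
        rw [hqp, ← hpe y hy, mul_right_comm, ← Complex.ofReal_mul, ← Real.exp_add]
        simp
      obtain ⟨c, hc⟩ : ∃ c : ℂ, ∀ y ∈ Set.Ioo y₁ (y₂ - δ),
          (∫ s in (0 : ℝ)..δ, κ (y + s)) - q.eval ((Real.exp y : ℝ) : ℂ) = c :=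
        isOpen_Ioo.exists_is_const_of_deriv_eq_zero isPreconnected_Ioo
          (fun y hy => (hder y hy).differentiableAt.differentiableWithinAt)
          fun y hy => (hder y hy).deriv
      refine ⟨q + Polynomial.C c, (Polynomial.degree_add_le _ _).trans_lt (max_lt hq ?_), ?_⟩
      · exact Polynomial.degree_C_le.trans_lt (by exact_mod_cast Nat.succ_pos n)
      · intro y hy
        rw [Polynomial.eval_add, Polynomial.eval_C, ← hc y hy]
        ring
    rcases le_or_gt y₂ y₁ with hy | hy
    · exact ⟨0, by simp, fun y h => absurd (h.1.trans h.2) hy.not_gt⟩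
    -- A polynomial of degree at most `n` is determined by its values at `n + 1` nodes in the
    -- left half of the interval, and this formula passes to the limit `δ → 0`.
    set x : ℕ → ℝ := fun i => y₁ + (y₂ - y₁) / 2 * ((i + 1) / (n + 2)) with hx
    set v : ℕ → ℂ := fun i => ((Real.exp (x i) : ℝ) : ℂ) with hv
    have hxmem : ∀ i ∈ Finset.range (n + 1), x i ∈ Set.Ioo y₁ (y₁ + (y₂ - y₁) / 2) := by
      intro i hi
      have hi : (i : ℝ) + 1 < n + 2 := by
        have := Finset.mem_range.1 hi
        exact_mod_cast (by omega : i + 1 < n + 2)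
      have h1 : 0 < ((i : ℝ) + 1) / (n + 2) := by positivity
      have h2 : ((i : ℝ) + 1) / (n + 2) < 1 := (div_lt_one (by positivity)).2 hi
      constructor <;> simp only [hx] <;> nlinarith
    have hinj : Set.InjOn v (Finset.range (n + 1)) := by
      intro i _ j _ hij
      have h1 := Real.exp_injective (Complex.ofReal_injective hij)
      simp only [hx] at h1
      have h2 := mul_left_cancel₀ (by linarith : (y₂ - y₁) / 2 ≠ 0) (add_left_cancel h1)
      have h3 : (n : ℝ) + 2 ≠ 0 := by positivity
      field_simp at h2
      exact_mod_cast add_right_cancel h2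
    refine ⟨Lagrange.interpolate (Finset.range (n + 1)) v fun i => κ (x i),
      by simpa using Lagrange.degree_interpolate_lt (fun i => κ (x i)) hinj, fun y hyI => ?_⟩
    have hlim := tendsto_finsetSum (Finset.range (n + 1)) fun i _ =>
      (tendsto_inv_smul_integral_add hκ (x i)).mul_const
        ((Lagrange.basis (Finset.range (n + 1)) v i).eval ((Real.exp y : ℝ) : ℂ))
    have heval : ∀ r : ℕ → ℂ, (Lagrange.interpolate (Finset.range (n + 1)) v r).eval
        ((Real.exp y : ℝ) : ℂ) = ∑ i ∈ Finset.range (n + 1),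
          r i * (Lagrange.basis (Finset.range (n + 1)) v i).eval ((Real.exp y : ℝ) : ℂ) := by
      intro r
      simp [Lagrange.interpolate_apply, Polynomial.eval_finsetSum]
    rw [heval]
    refine tendsto_nhds_unique (tendsto_inv_smul_integral_add hκ y) (hlim.congr' ?_)
    have hsmall : Set.Ioo (0 : ℝ) (min ((y₂ - y₁) / 2) (y₂ - y)) ∈ 𝓝[>] (0 : ℝ) :=
      Ioo_mem_nhdsGT (lt_min (by linarith) (by linarith [hyI.2]))
    filter_upwards [hsmall] with δ hδs
    obtain ⟨p, hp, hpe⟩ := hδ δ hδs.1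
    have hδ1 := hδs.2.trans_le (min_le_left _ _)
    have hδ2 := hδs.2.trans_le (min_le_right _ _)
    have hpi := Lagrange.eq_interpolate_of_eval_eq
      (fun i => ∫ s in (0 : ℝ)..δ, κ (x i + s)) hinj (f := p) (by simpa using hp)
      fun i hi => (hpe (x i) ⟨(hxmem i hi).1, by linarith [(hxmem i hi).2]⟩).symm
    rw [hpe y ⟨hyI.1, by linarith⟩, hpi, heval, Finset.mul_sum]
    exact Finset.sum_congr rfl fun i _ => by ring

/-! ### Fourier components of functions with vanishing circle averages -/

/-- The open annulus `R₁ < |z| < R₂`. -/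
def openAnnulus (R₁ R₂ : ℝ) : Set ℂ :=
  {z : ℂ | R₁ < ‖z‖ ∧ ‖z‖ < R₂}

/-- The superposition `∫ k(φ) F(e^{iφ} z) dφ` of the rotated copies of `F`, over a full turn. -/
noncomputable def rotationAverage (k : ℝ → ℂ) (F : ℂ → ℂ) (z : ℂ) : ℂ :=
  ∫ φ in -Real.pi..Real.pi, k φ * F (Complex.exp (φ * Complex.I) * z)

theorem continuous_rotationAverage {k : ℝ → ℂ} {F : ℂ → ℂ} (hk : Continuous k)
    (hF : Continuous F) : Continuous (rotationAverage k F) := by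
  refine intervalIntegral.continuous_parametric_intervalIntegral_of_continuous' ?_ _ _
  simp only [Function.uncurry_def]
  fun_prop

theorem circleAverage_comp_rotation (F : ℂ → ℂ) (φ : ℝ) (a : ℂ) (ρ : ℝ) :
    Real.circleAverage (fun z => F (Complex.exp (φ * Complex.I) * z)) a ρ =
      Real.circleAverage F (Complex.exp (φ * Complex.I) * a) ρ := by
  conv_rhs => rw [Real.circleAverage_eq_integral_add φ]
  rw [Real.circleAverage_def]
  congr 2
  ext θ
  simp only [circleMap]
  congr 1
  push_cast
  rw [add_mul, Complex.exp_add]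
  ring

theorem HasZeroCircleAverages.rotationAverage {k : ℝ → ℂ} {F : ℂ → ℂ} (hk : Continuous k)
    (hF : Continuous F) {R₁ R₂ : ℝ} (h : HasZeroCircleAverages F R₁ R₂) :
    HasZeroCircleAverages (rotationAverage k F) R₁ R₂ := by
  intro a ρ h1 h2
  have e : _root_.rotationAverage k F = fun z => ∫ φ in -Real.pi..Real.pi,
    k φ • F (Complex.exp (φ * Complex.I) * z) := rfl
  rw [e, circleAverage_intervalIntegral_swap]
  · refine (intervalIntegral.integral_congr fun φ _ => ?_).trans intervalIntegral.integral_zero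
    have hn : ‖Complex.exp (φ * Complex.I) * a‖ = ‖a‖ := by
      rw [norm_mul, Complex.norm_exp_ofReal_mul_I, one_mul]
    rw [Real.circleAverage_fun_smul, circleAverage_comp_rotation,
      h _ _ (by rwa [hn]) (by rwa [hn]), smul_zero]
  · simp only [circleMap]
    fun_prop

/-- The character `φ ↦ e^{-inφ}` of the circle; averaging against it extracts the `n`-th Fourier
component. -/
noncomputable def rotationCharacter (n : ℕ) (φ : ℝ) : ℂ :=
  Complex.exp (-(n * φ * Complex.I))

theorem continuous_rotationCharacter (n : ℕ) : Continuous (rotationCharacter n) := by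
  unfold rotationCharacter
  fun_prop

theorem rotationAverage_rotationCharacter_rotate (n : ℕ) (F : ℂ → ℂ) (α : ℝ) (z : ℂ) :
    rotationAverage (rotationCharacter n) F (Complex.exp (α * Complex.I) * z) =
      Complex.exp (α * Complex.I) ^ n * rotationAverage (rotationCharacter n) F z := by
  set ψ : ℝ → ℂ := fun φ => rotationCharacter n φ * F (Complex.exp (φ * Complex.I) * z) with hψ
  have hper : Function.Periodic ψ (2 * Real.pi) := by
    intro φ
    have e1 : Complex.exp (((φ + 2 * Real.pi : ℝ) : ℂ) * Complex.I) =
        Complex.exp (φ * Complex.I) := by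
      push_cast
      rw [add_mul]
      exact Complex.exp_periodic _
    have e2 : ∀ x : ℝ, rotationCharacter n x = (Complex.exp (x * Complex.I) ^ n)⁻¹ := by
      intro x
      rw [rotationCharacter, Complex.exp_neg, ← Complex.exp_nat_mul]
      ring_nf
    simp only [hψ, e2, e1]
  have hshift : ∫ φ in -Real.pi..Real.pi, ψ (φ + α) = ∫ φ in -Real.pi..Real.pi, ψ φ := by
    rw [intervalIntegral.integral_comp_add_right]
    have h := hper.intervalIntegral_add_eq (-Real.pi + α) (-Real.pi)
    rw [show -Real.pi + α + 2 * Real.pi = Real.pi + α by ring,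
      show -Real.pi + 2 * Real.pi = Real.pi by ring] at h
    exact h
  rw [show rotationAverage (rotationCharacter n) F z = ∫ φ in -Real.pi..Real.pi, ψ φ from rfl,
    ← hshift, ← intervalIntegral.integral_const_mul]
  refine intervalIntegral.integral_congr fun φ _ => ?_
  simp only [hψ, rotationCharacter]
  rw [← mul_assoc, ← mul_assoc, ← Complex.exp_nat_mul, ← Complex.exp_add, ← Complex.exp_add]
  congr 2
  · push_cast
    ring_nf
  · push_cast
    ring_nf

theorem rotationAverage_rotationCharacter_eq_radialTwist (n : ℕ) (F : ℂ → ℂ) {z : ℂ}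
    (hz : z ≠ 0) :
    rotationAverage (rotationCharacter n) F z = radialTwist n (fun y =>
      rotationAverage (rotationCharacter n) F (Real.exp (y / 2) : ℝ) *
        ((Real.exp (y / 2) : ℝ) : ℂ) ^ n) z := by
  have hn := norm_pos_iff.2 hz
  have h1 : Real.exp (2 * Real.log ‖z‖ / 2) = ‖z‖ := by
    rw [mul_div_cancel_left₀ _ two_ne_zero, Real.exp_log hn]
  have hE : Complex.exp (z.arg * Complex.I) ≠ 0 := Complex.exp_ne_zero _
  have hnC : (‖z‖ : ℂ) ≠ 0 := by exact_mod_cast hn.ne'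
  have h2 : z = Complex.exp (z.arg * Complex.I) * ‖z‖ := by
    rw [mul_comm]; exact (Complex.norm_mul_exp_arg_mul_I z).symm
  have h3 : conj z = (Complex.exp (z.arg * Complex.I))⁻¹ * ‖z‖ := by
    conv_lhs => rw [h2]
    rw [map_mul, Complex.conj_ofReal, ← Complex.exp_conj, ← Complex.exp_neg]
    simp
  have h4 := rotationAverage_rotationCharacter_rotate n F z.arg ‖z‖
  rw [← h2] at h4
  simp only [radialTwist, h1]
  rw [h4, h3, mul_pow, inv_pow]
  field_simp

/-- The span of the monomials `z ^ k * w⁻¹ ^ l` as functions on `ℂ²`. -/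
noncomputable def invPolynomial : Submodule ℂ (ℂ × ℂ → ℂ) :=
  Submodule.span ℂ (Set.range fun e : ℕ × ℕ => fun p : ℂ × ℂ => p.1 ^ e.1 * p.2⁻¹ ^ e.2)

/-- On the annulus `R₁ < |z| < R₂` the function `u` has the decomposition
`u z = G (z, z̄) / z̄ + H (z̄, z) / z`. -/
def IsDecomposable (R₁ R₂ : ℝ) (G H : ℂ × ℂ → ℂ) (u : ℂ → ℂ) : Prop :=
  ∀ z ∈ openAnnulus R₁ R₂, u z = (conj z)⁻¹ * G (z, conj z) + z⁻¹ * H (conj z, z)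

/-- The functions that have a decomposition `u z = G (z, z̄) / z̄ + H (z̄, z) / z` on the annulus
`R₁ < |z| < R₂`, with `G` and `H` in `invPolynomial`, form a linear space. -/
noncomputable def decomposable (R₁ R₂ : ℝ) : Submodule ℂ (ℂ → ℂ) where
  carrier := {u | ∃ G ∈ invPolynomial, ∃ H ∈ invPolynomial, IsDecomposable R₁ R₂ G H u}
  zero_mem' := ⟨0, zero_mem _, 0, zero_mem _, fun z _ => by simp⟩
  add_mem' := by
    rintro u v ⟨G, hG, H, hH, hu⟩ ⟨G', hG', H', hH', hv⟩
    refine ⟨G + G', add_mem hG hG', H + H', add_mem hH hH', fun z hz => ?_⟩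
    simp only [Pi.add_apply, hu z hz, hv z hz]
    ring
  smul_mem' := by
    rintro c u ⟨G, hG, H, hH, hu⟩
    refine ⟨c • G, Submodule.smul_mem _ c hG, c • H, Submodule.smul_mem _ c hH, fun z hz => ?_⟩
    simp only [Pi.smul_apply, hu z hz, smul_eq_mul]
    ring

/-- A Fourier component of nonnegative index is `G (z, z̄) / z̄` on the annulus. -/
theorem exists_rotationAverage_rotationCharacter_eq (n : ℕ) {F : ℂ → ℂ} (hF : Continuous F)
    {R₁ R₂ : ℝ} (hR₁ : 0 < R₁) (h : HasZeroCircleAverages F R₁ R₂) :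
    ∃ G ∈ invPolynomial, ∀ z ∈ openAnnulus R₁ R₂,
      rotationAverage (rotationCharacter n) F z = (conj z)⁻¹ * G (z, conj z) := by
  rcases le_or_gt R₂ R₁ with hR | hR
  · exact ⟨0, zero_mem _, fun z hz => absurd (hz.1.trans hz.2) hR.not_gt⟩
  have hR₂ := hR₁.trans hR
  have hexp : ∀ {R : ℝ}, 0 < R → Real.exp (2 * Real.log R / 2) = R := fun hR => by
    rw [mul_div_cancel_left₀ _ two_ne_zero, Real.exp_log hR]
  set κ : ℝ → ℂ := fun y => rotationAverage (rotationCharacter n) F (Real.exp (y / 2) : ℝ) *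
        ((Real.exp (y / 2) : ℝ) : ℂ) ^ n with hκ
  have hc := continuous_rotationAverage (continuous_rotationCharacter n) hF
  have hκc : Continuous κ := by
    rw [hκ]
    fun_prop
  have hzero : HasZeroCircleAverages (radialTwist n κ) (Real.exp (2 * Real.log R₁ / 2))
      (Real.exp (2 * Real.log R₂ / 2)) := by
    rw [hexp hR₁, hexp hR₂]
    intro a ρ h1 h2
    rw [← h.rotationAverage (continuous_rotationCharacter n) hF a ρ h1 h2]
    simp only [Real.circleAverage_def]
    congr 2
    ext θ
    exact (rotationAverage_rotationCharacter_eq_radialTwist n F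
      (circleMap_ne_zero_of_norm_lt (by linarith) θ)).symm
  obtain ⟨p, hp, hpe⟩ := exists_polynomial_of_hasZeroCircleAverages n hκc hzero
  refine ⟨∑ j ∈ Finset.range n, p.coeff j • fun q : ℂ × ℂ => q.1 ^ j * q.2⁻¹ ^ (n - 1 - j),
    Submodule.sum_mem _ fun j _ => Submodule.smul_mem _ _ (Submodule.subset_span ⟨(j, n - 1 - j),
      rfl⟩), fun z hz => ?_⟩
  have hn : 0 < ‖z‖ := hR₁.trans hz.1
  have hz0 := norm_pos_iff.1 hn
  have hzc : conj z ≠ 0 := by simpa using hz0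
  rw [rotationAverage_rotationCharacter_eq_radialTwist n F hz0]
  change κ (2 * Real.log ‖z‖) * (conj z ^ n)⁻¹ = _
  rw [hpe _ ⟨by have := Real.log_lt_log hR₁ hz.1; linarith,
    by have := Real.log_lt_log hn hz.2; linarith⟩]
  have e : ((Real.exp (2 * Real.log ‖z‖) : ℝ) : ℂ) = z * conj z := by
    rw [two_mul, Real.exp_add, Real.exp_log hn, Complex.mul_conj, Complex.normSq_eq_norm_sq, sq]
  rw [e]
  have hsum : p.eval (z * conj z) = ∑ j ∈ Finset.range n, p.coeff j * (z * conj z) ^ j := by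
    rcases n with _ | n
    · have : p = 0 := by simpa using hp
      simp [this]
    · refine Polynomial.eval_eq_sum_range' (Nat.lt_succ_of_le ?_) _
      exact Polynomial.natDegree_le_of_degree_le (Order.le_of_lt_succ hp)
  rw [hsum, Finset.sum_mul, Finset.sum_apply, Finset.mul_sum]
  refine Finset.sum_congr rfl fun j hj => ?_
  obtain ⟨m, rfl⟩ : ∃ m, n = j + 1 + m := ⟨n - (j + 1), by have := Finset.mem_range.1 hj; omega⟩
  have : j + 1 + m - 1 - j = m := by omega
  simp only [Pi.smul_apply, smul_eq_mul, this]
  rw [mul_pow, pow_add, pow_add, pow_one, inv_pow]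
  field_simp

theorem circleAverage_comp_conj (F : ℂ → ℂ) (a : ℂ) (ρ : ℝ) :
    Real.circleAverage (fun z => F (conj z)) a ρ = Real.circleAverage F (conj a) ρ := by
  have e : ∀ θ : ℝ, conj (circleMap a ρ θ) = circleMap (conj a) ρ (-θ) := by
    intro θ
    simp [circleMap, ← Complex.exp_conj]
  simp only [Real.circleAverage_def, e]
  congr 1
  rw [intervalIntegral.integral_comp_neg fun θ => F (circleMap (conj a) ρ θ)]
  have hper : Function.Periodic (fun θ => F (circleMap (conj a) ρ θ)) (2 * Real.pi) := fun x => by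
    simp [periodic_circleMap (conj a) ρ x]
  have h := hper.intervalIntegral_add_eq (-(2 * Real.pi)) 0
  simpa using h

theorem HasZeroCircleAverages.comp_conj {F : ℂ → ℂ} {R₁ R₂ : ℝ}
    (h : HasZeroCircleAverages F R₁ R₂) : HasZeroCircleAverages (fun z => F (conj z)) R₁ R₂ := by
  intro a ρ h1 h2
  rw [circleAverage_comp_conj]
  exact h _ _ (by simpa using h1) (by simpa using h2)

theorem rotationAverage_comp_conj (k : ℝ → ℂ) (F : ℂ → ℂ) (z : ℂ) :
    rotationAverage k (fun z => F (conj z)) (conj z) = rotationAverage (fun φ => k (-φ)) F z := by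
  have h := intervalIntegral.integral_comp_neg (a := -Real.pi) (b := Real.pi)
    fun φ : ℝ => k φ * F (conj (Complex.exp (φ * Complex.I) * conj z))
  rw [neg_neg] at h
  simp only [rotationAverage]
  rw [← h]
  refine intervalIntegral.integral_congr fun φ _ => ?_
  simp [← Complex.exp_conj]

theorem rotationAverage_exp_int_mem_decomposable (m : ℤ) {F : ℂ → ℂ} (hF : Continuous F)
    {R₁ R₂ : ℝ} (hR₁ : 0 < R₁) (h : HasZeroCircleAverages F R₁ R₂) :
    rotationAverage (fun φ => Complex.exp (m * φ * Complex.I)) F ∈ decomposable R₁ R₂ := by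
  obtain ⟨n, rfl | rfl⟩ := m.eq_nat_or_neg
  · obtain ⟨H, hH, he⟩ := exists_rotationAverage_rotationCharacter_eq n
      (hF.comp Complex.continuous_conj) hR₁ h.comp_conj
    refine ⟨0, zero_mem _, H, hH, fun z hz => ?_⟩
    have h1 := he (conj z) (by simpa [openAnnulus] using hz)
    simp only [Function.comp_def] at h1
    rw [rotationAverage_comp_conj, Complex.conj_conj] at h1
    simpa [rotationCharacter] using h1
  · obtain ⟨G, hG, he⟩ := exists_rotationAverage_rotationCharacter_eq n hF hR₁ h
    refine ⟨G, hG, 0, zero_mem _, fun z hz => ?_⟩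
    have e : (fun φ : ℝ => Complex.exp (((-(n : ℤ) : ℤ) : ℂ) * φ * Complex.I)) =
        rotationCharacter n := by
      ext φ
      simp [rotationCharacter]
    rw [e, he z hz]
    simp

theorem one_add_cos_pow_eq (N : ℕ) (φ : ℝ) :
    (((1 + Real.cos φ) ^ N : ℝ) : ℂ) = ∑ j ∈ Finset.range (2 * N + 1),
      ((2 * N).choose j / 2 ^ N : ℂ) * Complex.exp ((((j : ℤ) - N : ℤ) : ℂ) * φ * Complex.I) := by
  set E := Complex.exp (φ * Complex.I) with hE
  have hE0 : E ≠ 0 := Complex.exp_ne_zero _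
  have h1 : (1 + Complex.cos φ) = (E + 1) ^ 2 / (2 * E) := by
    rw [Complex.cos, neg_mul, Complex.exp_neg, ← hE]
    field_simp
    ring
  push_cast
  rw [h1, div_pow, ← pow_mul, add_pow, Finset.sum_div]
  refine Finset.sum_congr rfl fun j _ => ?_
  have h2 : Complex.exp (((j : ℂ) - N) * φ * Complex.I) = E ^ j / E ^ N := by
    rw [hE, ← Complex.exp_nat_mul, ← Complex.exp_nat_mul, ← Complex.exp_sub]
    congr 1
    ring
  rw [h2]
  field_simp
  ring

theorem rotationAverage_sum {ι : Type*} (s : Finset ι) (c : ι → ℂ) (k : ι → ℝ → ℂ)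
    (hk : ∀ i, Continuous (k i)) {F : ℂ → ℂ} (hF : Continuous F) :
    rotationAverage (fun φ => ∑ i ∈ s, c i * k i φ) F = ∑ i ∈ s, c i • rotationAverage (k i) F := by
  ext z
  simp only [rotationAverage, Finset.sum_apply, Pi.smul_apply, smul_eq_mul, Finset.sum_mul]
  rw [intervalIntegral.integral_finsetSum]
  · refine Finset.sum_congr rfl fun i _ => ?_
    rw [← intervalIntegral.integral_const_mul]
    simp only [mul_assoc]
  · intro i _
    have := hk i
    exact Continuous.intervalIntegrable (by fun_prop) _ _

theorem rotationAverage_one_add_cos_pow_mem_decomposable (N : ℕ) {F : ℂ → ℂ} (hF : Continuous F)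
    {R₁ R₂ : ℝ} (hR₁ : 0 < R₁) (h : HasZeroCircleAverages F R₁ R₂) :
    rotationAverage (fun φ => (((1 + Real.cos φ) ^ N : ℝ) : ℂ)) F ∈ decomposable R₁ R₂ := by
  simp only [one_add_cos_pow_eq]
  rw [rotationAverage_sum _ _ _ (fun j => by fun_prop) hF]
  exact Submodule.sum_mem _ fun j _ =>
    Submodule.smul_mem _ _ (rotationAverage_exp_int_mem_decomposable _ hF hR₁ h)

/-! ### Approximation by trigonometric means -/

theorem rotate_mem_openAnnulus {R₁ R₂ : ℝ} {z : ℂ} (hz : z ∈ openAnnulus R₁ R₂) (φ : ℝ) :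
    Complex.exp (φ * Complex.I) * z ∈ openAnnulus R₁ R₂ := by
  simpa [openAnnulus, Complex.norm_exp_ofReal_mul_I] using hz

theorem integral_one_add_cos_pow_pos (N : ℕ) :
    0 < ∫ φ in -Real.pi..Real.pi, (1 + Real.cos φ) ^ N := by
  refine intervalIntegral.intervalIntegral_pos_of_pos_on
    (Continuous.intervalIntegrable (by fun_prop) _ _) (fun φ hφ => ?_) (by linarith [Real.pi_pos])
  have : -1 < Real.cos φ := by
    have h := (Real.cos_eq_one_iff_of_lt_of_lt (x := φ - Real.pi)
      (by linarith [hφ.1]) (by linarith [hφ.2, Real.pi_pos])).not.2 (by linarith [hφ.2])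
    rw [Real.cos_sub_pi] at h
    exact lt_of_le_of_ne (Real.neg_one_le_cos φ) fun h' => h (by linarith)
  exact pow_pos (by linarith) N

/-- The average of the rotated copies of `F`, weighted by the normalized kernel `(1 + cos φ)ᴺ`. -/
noncomputable def cosineMean (N : ℕ) (F : ℂ → ℂ) : ℂ → ℂ :=
  ((∫ φ in -Real.pi..Real.pi, (1 + Real.cos φ) ^ N : ℝ) : ℂ)⁻¹ •
    rotationAverage (fun φ => (((1 + Real.cos φ) ^ N : ℝ) : ℂ)) F

theorem norm_weighted_integral_le (N : ℕ) {g : ℝ → ℂ} {b : ℝ → ℝ} (hb : Continuous b)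
    (hgb : ∀ φ, ‖g φ‖ ≤ b φ) :
    ‖((∫ φ in -Real.pi..Real.pi, (1 + Real.cos φ) ^ N : ℝ) : ℂ)⁻¹ *
        ∫ φ in -Real.pi..Real.pi, (((1 + Real.cos φ) ^ N : ℝ) : ℂ) * g φ‖ ≤
      (∫ φ in -Real.pi..Real.pi, (1 + Real.cos φ) ^ N)⁻¹ *
        ∫ φ in -Real.pi..Real.pi, (1 + Real.cos φ) ^ N * b φ := by
  have hW := integral_one_add_cos_pow_pos N
  rw [norm_mul, norm_inv, Complex.norm_real, Real.norm_of_nonneg hW.le]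
  refine mul_le_mul_of_nonneg_left ?_ (inv_nonneg.2 hW.le)
  refine intervalIntegral.norm_integral_le_of_norm_le (by linarith [Real.pi_pos])
    (.of_forall fun φ _ => ?_) (Continuous.intervalIntegrable (by fun_prop) _ _)
  have h0 : 0 ≤ (1 + Real.cos φ) ^ N := pow_nonneg (by linarith [Real.neg_one_le_cos φ]) N
  rw [norm_mul, Complex.norm_real, Real.norm_of_nonneg h0]
  exact mul_le_mul_of_nonneg_left (hgb φ) h0

theorem cosineMean_sub (N : ℕ) {F : ℂ → ℂ} (hF : Continuous F) (x y : ℂ) :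
    cosineMean N F x - cosineMean N F y =
      ((∫ φ in -Real.pi..Real.pi, (1 + Real.cos φ) ^ N : ℝ) : ℂ)⁻¹ *
        ∫ φ in -Real.pi..Real.pi, (((1 + Real.cos φ) ^ N : ℝ) : ℂ) *
          (F (Complex.exp (φ * Complex.I) * x) - F (Complex.exp (φ * Complex.I) * y)) := by
  simp only [cosineMean, Pi.smul_apply, smul_eq_mul, rotationAverage, mul_sub (_ : ℂ) (F _)]
  rw [← mul_sub]
  have hint : ∀ x : ℂ, IntervalIntegrable (fun φ : ℝ => (((1 + Real.cos φ) ^ N : ℝ) : ℂ) *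
      F (Complex.exp (φ * Complex.I) * x)) MeasureTheory.volume (-Real.pi) Real.pi :=
    fun x => Continuous.intervalIntegrable (by fun_prop) _ _
  rw [← intervalIntegral.integral_sub (hint x) (hint y)]

theorem cosineMean_sub_self (N : ℕ) {F : ℂ → ℂ} (hF : Continuous F) (z : ℂ) :
    cosineMean N F z - F z =
      ((∫ φ in -Real.pi..Real.pi, (1 + Real.cos φ) ^ N : ℝ) : ℂ)⁻¹ *
        ∫ φ in -Real.pi..Real.pi, (((1 + Real.cos φ) ^ N : ℝ) : ℂ) *
          (F (Complex.exp (φ * Complex.I) * z) - F z) := by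
  have hW : ((∫ φ in -Real.pi..Real.pi, (1 + Real.cos φ) ^ N : ℝ) : ℂ) ≠ 0 := by
    exact_mod_cast (integral_one_add_cos_pow_pos N).ne'
  have h1 : F z = ((∫ φ in -Real.pi..Real.pi, (1 + Real.cos φ) ^ N : ℝ) : ℂ)⁻¹ *
      ∫ φ in -Real.pi..Real.pi, (((1 + Real.cos φ) ^ N : ℝ) : ℂ) * F z := by
    rw [intervalIntegral.integral_mul_const, intervalIntegral.integral_ofReal, ← mul_assoc,
      inv_mul_cancel₀ hW, one_mul]
  conv_lhs => rw [h1]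
  simp only [cosineMean, Pi.smul_apply, smul_eq_mul, rotationAverage, ← mul_sub]
  rw [← intervalIntegral.integral_sub]
  · simp only [mul_sub]
  · exact Continuous.intervalIntegrable (by fun_prop) _ _
  · exact Continuous.intervalIntegrable (by fun_prop) _ _

theorem tendsto_weighted_integral {b : ℝ → ℝ} (hb : Continuous b) :
    Tendsto (fun N : ℕ => (∫ φ in -Real.pi..Real.pi, (1 + Real.cos φ) ^ N)⁻¹ *
      ∫ φ in -Real.pi..Real.pi, (1 + Real.cos φ) ^ N * b φ) atTop (𝓝 (b 0)) := by
  have hpi := Real.pi_pos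
  have h := tendsto_setIntegral_pow_smul_of_unique_maximum_of_isCompact_of_continuousOn
    (μ := MeasureTheory.volume) (s := Set.Icc (-Real.pi) Real.pi) (x₀ := 0) (g := b)
    (c := fun φ => 1 + Real.cos φ) isCompact_Icc (by fun_prop) (fun φ hφ h0 => ?_) (fun φ _ => ?_)
    (by norm_num) ?_ hb.continuousOn
  · refine h.congr fun N => ?_
    rw [intervalIntegral.integral_of_le (by linarith),
      intervalIntegral.integral_of_le (by linarith),
      ← MeasureTheory.integral_Icc_eq_integral_Ioc, ← MeasureTheory.integral_Icc_eq_integral_Ioc]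
    rfl
  · have h1 := (Real.cos_eq_one_iff_of_lt_of_lt (x := φ) (by linarith [hφ.1])
      (by linarith [hφ.2])).not.2 h0
    have := lt_of_le_of_ne (Real.cos_le_one φ) h1
    simpa using this
  · linarith [Real.neg_one_le_cos φ]
  · rw [interior_Icc, closure_Ioo (by linarith)]
    constructor <;> linarith

/-- A Hölder continuous function whose averages over the circles around the origin vanish is the
uniform limit on the annulus of decomposable functions that satisfy the same Hölder bound. -/
theorem exists_decomposable_tendstoUniformlyOn {F : ℂ → ℂ} (hF : Continuous F) {R₁ R₂ : ℝ}
    (hR₁ : 0 < R₁) (h : HasZeroCircleAverages F R₁ R₂) {C α : ℝ} (hC : 0 ≤ C) (hα : 0 < α)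
    (hH : ∀ x ∈ openAnnulus R₁ R₂, ∀ y ∈ openAnnulus R₁ R₂, ‖F x - F y‖ ≤ C * ‖x - y‖ ^ α) :
    ∃ u : ℕ → ℂ → ℂ, (∀ N, u N ∈ decomposable R₁ R₂) ∧
      (∀ N, ∀ x ∈ openAnnulus R₁ R₂, ∀ y ∈ openAnnulus R₁ R₂,
        ‖u N x - u N y‖ ≤ C * ‖x - y‖ ^ α) ∧
      TendstoUniformlyOn u F atTop (openAnnulus R₁ R₂) := by
  refine ⟨fun N => cosineMean N F, fun N => Submodule.smul_mem _ _
    (rotationAverage_one_add_cos_pow_mem_decomposable N hF hR₁ h), fun N x hx y hy => ?_, ?_⟩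
  · rw [cosineMean_sub N hF]
    refine (norm_weighted_integral_le N (b := fun _ => C * ‖x - y‖ ^ α) continuous_const fun φ =>
      (hH _ (rotate_mem_openAnnulus hx φ) _ (rotate_mem_openAnnulus hy φ)).trans_eq ?_).trans_eq ?_
    · rw [← mul_sub, norm_mul, Complex.norm_exp_ofReal_mul_I, one_mul]
    · rw [intervalIntegral.integral_mul_const, ← mul_assoc,
        inv_mul_cancel₀ (integral_one_add_cos_pow_pos N).ne', one_mul]
  · have hbc : Continuous fun φ : ℝ => C * (‖Complex.exp (φ * Complex.I) - 1‖ * R₂) ^ α :=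
      continuous_const.mul ((by fun_prop : Continuous fun φ : ℝ =>
        ‖Complex.exp (φ * Complex.I) - 1‖ * R₂).rpow_const fun _ => Or.inr hα.le)
    have hlim := tendsto_weighted_integral hbc
    simp only [Complex.ofReal_zero, zero_mul, Complex.exp_zero, sub_self, norm_zero,
      Real.zero_rpow hα.ne', mul_zero] at hlim
    rw [Metric.tendstoUniformlyOn_iff]
    intro ε hε
    filter_upwards [hlim.eventually_lt_const hε] with N hN z hz
    rw [dist_comm, dist_eq_norm, cosineMean_sub_self N hF]
    refine (norm_weighted_integral_le N hbc fun φ =>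
      (hH _ (rotate_mem_openAnnulus hz φ) _ hz).trans ?_).trans_lt hN
    refine mul_le_mul_of_nonneg_left (Real.rpow_le_rpow (norm_nonneg _) ?_ hα.le) hC
    rw [← sub_one_mul, norm_mul]
    exact mul_le_mul_of_nonneg_left hz.2.le (norm_nonneg _)

/-! ### The Cauchy integral over a circle around the origin -/

/-- On the circle with centre `a` and radius `ρ` the function `1 / ζ̄` agrees with this function,
which is holomorphic in the closed disc if the circle surrounds the origin. -/
noncomputable def invConjExtension (a : ℂ) (ρ : ℝ) (ζ : ℂ) : ℂ :=
  (ζ - a) / (ρ ^ 2 + conj a * (ζ - a))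

theorem sq_add_mul_ne_zero {b c : ℂ} {ρ : ℝ} (hb : ‖b‖ < ρ) (hc : ‖c‖ ≤ ρ) :
    (ρ : ℂ) ^ 2 + b * c ≠ 0 := by
  intro h
  have h1 : ‖b * c‖ = ρ ^ 2 := by
    rw [eq_neg_of_add_eq_zero_right h, norm_neg, norm_pow, Complex.norm_real, Real.norm_eq_abs,
      sq_abs]
  rw [norm_mul] at h1
  nlinarith [norm_nonneg b, norm_nonneg c]

theorem differentiableOn_invConjExtension {a : ℂ} {ρ : ℝ} (ha : ‖a‖ < ρ) :
    DifferentiableOn ℂ (invConjExtension a ρ) (Metric.closedBall a ρ) := by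
  unfold invConjExtension
  refine DifferentiableOn.div (by fun_prop) (by fun_prop) fun ζ hζ => ?_
  exact sq_add_mul_ne_zero (by simpa using ha) (by simpa [dist_eq_norm] using hζ)

/-- The second coordinate of the point of `(z - a) (w - ā) = ρ²` over `ζ`. -/
theorem inv_invConjExtension {a ζ : ℂ} {ρ : ℝ} (hζ : ζ ≠ a) :
    (invConjExtension a ρ ζ)⁻¹ = conj a + ρ ^ 2 / (ζ - a) := by
  have : ζ - a ≠ 0 := sub_ne_zero.2 hζ
  rw [invConjExtension, inv_div]
  field_simp
  ring

theorem conj_eq_add_div_of_mem_sphere {a ζ : ℂ} {ρ : ℝ} (hρ : 0 < ρ)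
    (hζ : ζ ∈ Metric.sphere a ρ) : conj ζ = conj a + ρ ^ 2 / (ζ - a) := by
  have h1 : ‖ζ - a‖ = ρ := by simpa [dist_eq_norm] using hζ
  have h2 : ζ - a ≠ 0 := norm_pos_iff.1 (by rw [h1]; exact hρ)
  have h3 : (ζ - a) * conj (ζ - a) = ρ ^ 2 := by
    rw [Complex.mul_conj, Complex.normSq_eq_norm_sq, h1]
    push_cast
    rfl
  rw [← h3, mul_div_cancel_left₀ _ h2, map_sub]
  ring

theorem inv_invConjExtension_of_mem_sphere {a ζ : ℂ} {ρ : ℝ} (hρ : 0 < ρ)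
    (hζ : ζ ∈ Metric.sphere a ρ) : (invConjExtension a ρ ζ)⁻¹ = conj ζ := by
  rw [conj_eq_add_div_of_mem_sphere hρ hζ, inv_invConjExtension]
  rintro rfl
  simp at hζ
  linarith

/-- A function in `invPolynomial`, restricted to the curve `Λ⁺`, extends holomorphically over the
puncture `ζ = a` of the disc. -/
theorem differentiableOn_invPolynomial_comp {G : ℂ × ℂ → ℂ} (hG : G ∈ invPolynomial) {a : ℂ}
    {ρ : ℝ} (ha : ‖a‖ < ρ) :
    DifferentiableOn ℂ (fun ζ => G (ζ, (invConjExtension a ρ ζ)⁻¹)) (Metric.closedBall a ρ) := by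
  induction hG using Submodule.span_induction with
  | mem G hG =>
    obtain ⟨⟨k, l⟩, rfl⟩ := hG
    simp only [inv_inv]
    exact (differentiableOn_id.pow k).mul ((differentiableOn_invConjExtension ha).pow l)
  | zero => exact differentiableOn_const 0
  | add G G' _ _ h h' => exact h.add h'
  | smul c G _ h => exact h.const_smul c

theorem circleAverage_cauchy_mul_invPolynomial {G : ℂ × ℂ → ℂ} (hG : G ∈ invPolynomial) {a z : ℂ}
    {ρ : ℝ} (ha : ‖a‖ < ρ) (hz : ‖z - a‖ < ρ) (hza : z ≠ a) :
    Real.circleAverage (fun ζ => (ζ - a) / (ζ - z) * G (ζ, conj ζ)) a ρ =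
      G (z, conj a + ρ ^ 2 / (z - a)) := by
  have hρ : 0 < ρ := (norm_nonneg a).trans_lt ha
  have hd := (differentiableOn_invPolynomial_comp hG ha).diffContOnCl_ball subset_rfl
  rw [← abs_of_pos hρ] at hd
  have h := DiffContOnCl.circleAverage_smul_div (w := z) hd
    (by simpa [abs_of_pos hρ, dist_eq_norm] using hz)
  rw [abs_of_pos hρ, inv_invConjExtension hza] at h
  rw [← h]
  refine Real.circleAverage_congr_sphere fun ζ hζ => ?_
  rw [abs_of_pos hρ] at hζ
  simp only [smul_eq_mul]
  rw [inv_invConjExtension_of_mem_sphere hρ hζ]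

/-- The part of the decomposition that extends to the outside of the disc does not contribute to
the Cauchy integral. Conjugation turns the outside into the inside, and the integrand into a
function that vanishes at the centre. -/
theorem circleAverage_cauchy_mul_conj_eq_zero {H : ℂ × ℂ → ℂ} (hH : H ∈ invPolynomial) {a z : ℂ}
    {ρ : ℝ} (ha : ‖a‖ < ρ) (hz : ‖z - a‖ < ρ) :
    Real.circleAverage (fun ζ => (ζ - a) / (ζ - z) * (conj ζ * (ζ⁻¹ * H (conj ζ, ζ)))) a ρ = 0 := by
  have hρ : 0 < ρ := (norm_nonneg a).trans_lt ha
  have hac : ‖conj a‖ < ρ := by simpa using ha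
  set b := conj a with hb
  set g : ℂ → ℂ := fun η => ρ ^ 2 / (ρ ^ 2 + (-(z - a)) * (η - b)) *
    (η * (invConjExtension b ρ η * H (η, (invConjExtension b ρ η)⁻¹))) with hg
  have hgd : DifferentiableOn ℂ g (Metric.closedBall b ρ) := by
    refine DifferentiableOn.mul (DifferentiableOn.div (by fun_prop) (by fun_prop) fun η hη => ?_)
      (differentiableOn_id.mul ((differentiableOn_invConjExtension hac).mul
        (differentiableOn_invPolynomial_comp hH hac)))
    exact sq_add_mul_ne_zero (by rwa [norm_neg]) (by simpa [dist_eq_norm] using hη)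
  have hmean : Real.circleAverage g b ρ = 0 := by
    have := DiffContOnCl.circleAverage (c := b) (R := ρ) (f := g)
      (by rw [abs_of_pos hρ]; exact hgd.diffContOnCl_ball subset_rfl)
    rw [this]
    simp [hg, invConjExtension]
  have e := circleAverage_comp_conj
    (fun η => (conj η - a) / (conj η - z) * (η * ((conj η)⁻¹ * H (η, conj η)))) a ρ
  simp only [Complex.conj_conj] at e
  rw [e, ← hmean]
  refine Real.circleAverage_congr_sphere fun η hη => ?_
  rw [abs_of_pos hρ] at hη
  have hηb : η - b ≠ 0 := by
    refine norm_pos_iff.1 ?_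
    rw [← dist_eq_norm, Metric.mem_sphere.1 hη]
    exact hρ
  have hden : (ρ : ℂ) ^ 2 + (-(z - a)) * (η - b) ≠ 0 :=
    sq_add_mul_ne_zero (by rwa [norm_neg]) (by rw [← dist_eq_norm, Metric.mem_sphere.1 hη])
  have h1 := conj_eq_add_div_of_mem_sphere hρ hη
  have h2 := inv_invConjExtension_of_mem_sphere hρ hη
  have h3 : invConjExtension b ρ η = (conj η)⁻¹ := by rw [← h2, inv_inv]
  simp only [hg]
  rw [h3, inv_inv]
  congr 1
  have hca : conj b = a := by rw [hb, Complex.conj_conj]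
  rw [h1, hca]
  have e1 : a + (ρ : ℂ) ^ 2 / (η - b) - a = ρ ^ 2 / (η - b) := by ring
  have e2 : a + (ρ : ℂ) ^ 2 / (η - b) - z = (ρ ^ 2 + (-(z - a)) * (η - b)) / (η - b) := by
    field_simp
    ring
  rw [e1, e2, div_div_div_cancel_right₀ hηb]

theorem differentiableOn_of_mem_invPolynomial {G : ℂ × ℂ → ℂ} (hG : G ∈ invPolynomial) :
    DifferentiableOn ℂ G {p | p.2 ≠ 0} := by
  induction hG using Submodule.span_induction with
  | mem G hG =>
    obtain ⟨⟨k, l⟩, rfl⟩ := hG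
    exact (differentiableOn_fst.pow k).mul ((differentiableOn_snd.inv fun p hp => hp).pow l)
  | zero => exact differentiableOn_const 0
  | add G G' _ _ h h' => exact h.add h'
  | smul c G _ h => exact h.const_smul c

theorem sphere_subset_openAnnulus {R₁ R₂ ρ : ℝ} {a : ℂ} (hρ : 0 ≤ ρ) (h1 : R₁ < ρ - ‖a‖)
    (h2 : ρ + ‖a‖ < R₂) : Metric.sphere a ρ ⊆ openAnnulus R₁ R₂ := by
  intro ζ hζ
  rw [← abs_of_nonneg hρ, ← range_circleMap] at hζ
  obtain ⟨θ, rfl⟩ := hζ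
  exact ⟨h1.trans_le (sub_norm_le_norm_circleMap a hρ θ),
    (norm_circleMap_le_add a hρ θ).trans_lt h2⟩

/-- The part `G` of a decomposition is, on each curve `Λ⁺`, the Cauchy integral of the function
`ζ̄ u(ζ)` over the corresponding circle. -/
theorem IsDecomposable.circleAverage_eq {R₁ R₂ : ℝ} (hR₁ : 0 ≤ R₁) {G H : ℂ × ℂ → ℂ} {u : ℂ → ℂ}
    (hG : G ∈ invPolynomial) (hH : H ∈ invPolynomial) (hu : IsDecomposable R₁ R₂ G H u)
    {a z : ℂ} {ρ : ℝ} (h1 : R₁ < ρ - ‖a‖) (h2 : ρ + ‖a‖ < R₂) (hz : ‖z - a‖ < ρ) (hza : z ≠ a) :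
    Real.circleAverage (fun ζ => (ζ - a) / (ζ - z) * (conj ζ * u ζ)) a ρ =
      G (z, conj a + ρ ^ 2 / (z - a)) := by
  have ha : ‖a‖ < ρ := by linarith
  have hρ : 0 < ρ := (norm_nonneg a).trans_lt ha
  have hmem : ∀ ζ ∈ Metric.sphere a ρ, ζ ∈ openAnnulus R₁ R₂ :=
    fun ζ hζ => sphere_subset_openAnnulus hρ.le h1 h2 hζ
  have hne : ∀ ζ ∈ Metric.sphere a ρ, ζ ≠ 0 := fun ζ hζ =>
    norm_pos_iff.1 (hR₁.trans_lt (hmem ζ hζ).1)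
  have hnec : ∀ ζ ∈ Metric.sphere a ρ, conj ζ ≠ 0 := fun ζ hζ => by simpa using hne ζ hζ
  have hker : ContinuousOn (fun ζ => (ζ - a) / (ζ - z)) (Metric.sphere a ρ) := by
    refine ContinuousOn.div (by fun_prop) (by fun_prop) fun ζ hζ h => ?_
    rw [sub_eq_zero.1 h, Metric.mem_sphere, dist_eq_norm] at hζ
    exact hz.ne hζ
  have hcc := Complex.continuous_conj.continuousOn (s := Metric.sphere a ρ)
  have hA : CircleIntegrable (fun ζ => (ζ - a) / (ζ - z) * G (ζ, conj ζ)) a ρ := by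
    refine ContinuousOn.circleIntegrable hρ.le (hker.mul ?_)
    exact (differentiableOn_of_mem_invPolynomial hG).continuousOn.comp
      (continuousOn_id.prodMk hcc) hnec
  have hB : CircleIntegrable
      (fun ζ => (ζ - a) / (ζ - z) * (conj ζ * (ζ⁻¹ * H (conj ζ, ζ)))) a ρ := by
    refine ContinuousOn.circleIntegrable hρ.le (hker.mul (hcc.mul
      ((continuousOn_id.inv₀ hne).mul ?_)))
    exact (differentiableOn_of_mem_invPolynomial hH).continuousOn.comp
      (hcc.prodMk continuousOn_id) hne
  rw [← circleAverage_cauchy_mul_invPolynomial hG ha hz hza,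
    ← add_zero (Real.circleAverage (fun ζ => (ζ - a) / (ζ - z) * G (ζ, conj ζ)) a ρ),
    ← circleAverage_cauchy_mul_conj_eq_zero hH ha hz, ← Real.circleAverage_fun_add hA hB]
  refine Real.circleAverage_congr_sphere fun ζ hζ => ?_
  rw [abs_of_pos hρ] at hζ
  have := hnec ζ hζ
  rw [hu ζ (hmem ζ hζ)]
  field_simp

theorem two_div_pi_mul_abs_le_norm_exp_sub_one {θ : ℝ} (hθ : |θ| ≤ Real.pi) :
    2 / Real.pi * |θ| ≤ ‖Complex.exp (θ * Complex.I) - 1‖ := by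
  have h := Real.mul_abs_le_abs_sin (x := θ / 2)
    (by rw [abs_div, abs_two]; linarith)
  rw [abs_div, abs_two] at h
  rw [mul_comm (θ : ℂ), Complex.norm_exp_I_mul_ofReal_sub_one, norm_mul, Real.norm_eq_abs,
    Real.norm_eq_abs, abs_two]
  linarith

theorem intervalIntegrable_mul_abs_rpow {c r : ℝ} (hc : 0 ≤ c) (hr : -1 < r) (b : ℝ) :
    IntervalIntegrable (fun θ : ℝ => (c * |θ|) ^ r) MeasureTheory.volume (-b) b := by
  have hpos : ∀ b : ℝ, 0 ≤ b →
      IntervalIntegrable (fun θ : ℝ => (c * |θ|) ^ r) MeasureTheory.volume 0 b := by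
    intro b hb
    refine ((intervalIntegral.intervalIntegrable_rpow' hr (a := 0) (b := b)).const_mul
      (c ^ r)).congr fun θ hθ => ?_
    rw [Set.uIoc_of_le hb] at hθ
    rw [abs_of_pos hθ.1, Real.mul_rpow hc hθ.1.le]
  have hall : ∀ b : ℝ,
      IntervalIntegrable (fun θ : ℝ => (c * |θ|) ^ r) MeasureTheory.volume 0 b := by
    intro b
    rcases le_total 0 b with hb | hb
    · exact hpos b hb
    · have := (IntervalIntegrable.iff_comp_neg).1 (hpos (-b) (by linarith))
      simpa using this
  exact (hall (-b)).symm.trans (hall b)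

/-- The Cauchy integral of a Hölder continuous function over a circle is bounded in the disc. The
Cauchy kernel is compared with its value at the point of the circle that is nearest to `z`. The
constant is uniform for the radii between `R₁` and `R₂`. -/
theorem norm_circleAverage_cauchy_le {v : ℂ → ℂ} {a z : ℂ} {ρ R₁ R₂ β M K : ℝ} (hR₁ : 0 < R₁)
    (h1 : R₁ ≤ ρ) (h2 : ρ ≤ R₂) (hβ : 0 < β) (hβ1 : β ≤ 1) (hz : ‖z - a‖ < ρ)
    (hK : 0 ≤ K) (hvc : ContinuousOn v (Metric.sphere a ρ))
    (hM : ∀ ζ ∈ Metric.sphere a ρ, ‖v ζ‖ ≤ M)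
    (hv : ∀ ζ ∈ Metric.sphere a ρ, ∀ ξ ∈ Metric.sphere a ρ, ‖v ζ - v ξ‖ ≤ K * ‖ζ - ξ‖ ^ β) :
    ‖Real.circleAverage (fun ζ => (ζ - a) / (ζ - z) * v ζ) a ρ‖ ≤
      M + 2 * R₂ * K * ∫ θ in -Real.pi..Real.pi, (R₁ * (2 / Real.pi) * |θ|) ^ (β - 1) := by
  have hρ : 0 < ρ := hR₁.trans_le h1
  have hR₂ : 0 < R₂ := hρ.trans_le h2
  have hpi := Real.pi_pos
  -- The point of the circle on the ray from `a` through `z`.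
  set θ₀ := (z - a).arg with hθ₀
  set ξ := circleMap a ρ θ₀ with hξ
  have hξs : ξ ∈ Metric.sphere a ρ := circleMap_mem_sphere a hρ.le θ₀
  have hzξ : ‖ξ - z‖ = ρ - ‖z - a‖ := by
    have e : ξ - z = ((ρ - ‖z - a‖ : ℝ) : ℂ) * Complex.exp (θ₀ * Complex.I) := by
      have := Complex.norm_mul_exp_arg_mul_I (z - a)
      rw [← hθ₀] at this
      rw [hξ, circleMap]
      push_cast
      rw [sub_mul, this]
      ring
    rw [e, norm_mul, Complex.norm_exp_ofReal_mul_I, mul_one, Complex.norm_real,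
      Real.norm_of_nonneg (by linarith)]
  have hfar : ∀ ζ ∈ Metric.sphere a ρ, ρ - ‖z - a‖ ≤ ‖ζ - z‖ := by
    intro ζ hζ
    rw [Metric.mem_sphere, dist_eq_norm] at hζ
    have := norm_add_le (ζ - z) (z - a)
    rw [sub_add_sub_cancel, hζ] at this
    linarith
  have hhalf : ∀ ζ ∈ Metric.sphere a ρ, ‖ζ - ξ‖ ≤ 2 * ‖ζ - z‖ := by
    intro ζ hζ
    have := norm_sub_le_norm_sub_add_norm_sub ζ z ξ
    rw [norm_sub_rev z ξ, hzξ] at this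
    linarith [hfar ζ hζ]
  have hker : ContinuousOn (fun ζ => (ζ - a) / (ζ - z)) (Metric.sphere a ρ) := by
    refine ContinuousOn.div (by fun_prop) (by fun_prop) fun ζ hζ h => ?_
    have := hfar ζ hζ
    rw [h, norm_zero] at this
    linarith
  have hsplit : Real.circleAverage (fun ζ => (ζ - a) / (ζ - z) * v ζ) a ρ =
      v ξ + Real.circleAverage (fun ζ => (ζ - a) / (ζ - z) * (v ζ - v ξ)) a ρ := by
    have hd : DiffContOnCl ℂ (fun _ : ℂ => v ξ) (Metric.ball a |ρ|) := diffContOnCl_const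
    have hconst := DiffContOnCl.circleAverage_smul_div (w := z) hd
      (by simpa [abs_of_pos hρ, dist_eq_norm] using hz)
    simp only [smul_eq_mul] at hconst
    have hadd := Real.circleAverage_fun_add
      (f₁ := fun ζ => (ζ - a) / (ζ - z) * v ξ) (f₂ := fun ζ => (ζ - a) / (ζ - z) * (v ζ - v ξ))
      ((hker.mul (continuousOn_const (c := v ξ))).circleIntegrable hρ.le)
      ((hker.mul (hvc.sub (continuousOn_const (c := v ξ)))).circleIntegrable hρ.le)
    rw [hconst] at hadd
    rw [← hadd]
    simp only [mul_sub, add_sub_cancel]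
  rw [hsplit]
  refine (norm_add_le _ _).trans (add_le_add (hM ξ hξs) ?_)
  have hshift : Real.circleAverage (fun ζ => (ζ - a) / (ζ - z) * (v ζ - v ξ)) a ρ =
      (2 * Real.pi)⁻¹ • ∫ θ in -Real.pi..Real.pi,
        (circleMap a ρ (θ + θ₀) - a) / (circleMap a ρ (θ + θ₀) - z) *
          (v (circleMap a ρ (θ + θ₀)) - v ξ) := by
    rw [Real.circleAverage_eq_integral_add θ₀]
    congr 1
    have hper : Function.Periodic (fun θ => (circleMap a ρ (θ + θ₀) - a) /
        (circleMap a ρ (θ + θ₀) - z) * (v (circleMap a ρ (θ + θ₀)) - v ξ)) (2 * Real.pi) := by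
      intro θ
      have : circleMap a ρ (θ + 2 * Real.pi + θ₀) = circleMap a ρ (θ + θ₀) := by
        rw [add_right_comm, periodic_circleMap a ρ]
      simp only [this]
    have h := hper.intervalIntegral_add_eq 0 (-Real.pi)
    rwa [zero_add, show -Real.pi + 2 * Real.pi = Real.pi by ring] at h
  have hbound : ∀ θ ∈ Set.Ioc (-Real.pi) Real.pi,
      ‖(circleMap a ρ (θ + θ₀) - a) / (circleMap a ρ (θ + θ₀) - z) *
          (v (circleMap a ρ (θ + θ₀)) - v ξ)‖ ≤
        2 * R₂ * K * (R₁ * (2 / Real.pi) * |θ|) ^ (β - 1) := by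
    intro θ hθ
    set ζ := circleMap a ρ (θ + θ₀) with hζ
    have hζs : ζ ∈ Metric.sphere a ρ := circleMap_mem_sphere a hρ.le _
    have hpos : 0 ≤ 2 * R₂ * K * (R₁ * (2 / Real.pi) * |θ|) ^ (β - 1) := by positivity
    rcases eq_or_ne θ 0 with rfl | hθ0
    · have : ζ = ξ := by rw [hζ, hξ, zero_add]
      rw [this, sub_self, mul_zero, norm_zero]
      simpa using hpos
    have hdist : R₁ * (2 / Real.pi) * |θ| ≤ ‖ζ - ξ‖ := by
      have e : ζ - ξ = ρ * Complex.exp (θ₀ * Complex.I) * (Complex.exp (θ * Complex.I) - 1) := by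
        simp only [hζ, hξ, circleMap]
        push_cast
        rw [add_mul, Complex.exp_add]
        ring
      rw [e, norm_mul, norm_mul, Complex.norm_exp_ofReal_mul_I, mul_one, Complex.norm_real,
        Real.norm_of_nonneg hρ.le, mul_assoc]
      exact mul_le_mul h1 (two_div_pi_mul_abs_le_norm_exp_sub_one (abs_le.2 ⟨hθ.1.le, hθ.2⟩))
        (by positivity) hρ.le
    have hbase : 0 < R₁ * (2 / Real.pi) * |θ| := by positivity
    have hζξ : 0 < ‖ζ - ξ‖ := hbase.trans_le hdist
    have hζz : 0 < ‖ζ - z‖ := by linarith [hhalf ζ hζs]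
    have hζa : ‖ζ - a‖ = ρ := by rwa [Metric.mem_sphere, dist_eq_norm] at hζs
    rw [norm_mul, norm_div, hζa]
    calc ρ / ‖ζ - z‖ * ‖v ζ - v ξ‖
        ≤ 2 * R₂ / ‖ζ - ξ‖ * (K * ‖ζ - ξ‖ ^ β) := by
          refine mul_le_mul ?_ (hv ζ hζs ξ hξs) (norm_nonneg _) (by positivity)
          rw [div_le_div_iff₀ hζz hζξ]
          nlinarith [hhalf ζ hζs]
      _ = 2 * R₂ * K * ‖ζ - ξ‖ ^ (β - 1) := by
          rw [Real.rpow_sub_one hζξ.ne']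
          ring
      _ ≤ 2 * R₂ * K * (R₁ * (2 / Real.pi) * |θ|) ^ (β - 1) := by
          refine mul_le_mul_of_nonneg_left ?_ (by positivity)
          exact Real.rpow_le_rpow_of_nonpos hbase hdist (by linarith)
  have hint := (intervalIntegrable_mul_abs_rpow (c := R₁ * (2 / Real.pi)) (r := β - 1)
    (by positivity) (by linarith) Real.pi).const_mul (2 * R₂ * K)
  have hle := intervalIntegral.norm_integral_le_of_norm_le (by linarith) (.of_forall hbound) hint
  rw [intervalIntegral.integral_const_mul] at hle
  rw [hshift, norm_smul, Real.norm_of_nonneg (by positivity)]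
  refine (mul_le_of_le_one_left (norm_nonneg _) ?_).trans hle
  exact inv_le_one_of_one_le₀ (by linarith [Real.two_le_pi])

/-- The part `G` of the decomposition of `u` is bounded on the curves `Λ⁺` by the supremum norm and
the Hölder constant of `u`, uniformly in the curve. -/
theorem exists_norm_le_of_isDecomposable {R₁ R₂ β : ℝ} (hR₁ : 0 < R₁) (hR₂ : 0 < R₂) (hβ : 0 < β)
    (hβ1 : β ≤ 1) :
    ∃ K₀ : ℝ, 0 ≤ K₀ ∧ ∀ G ∈ invPolynomial, ∀ H ∈ invPolynomial, ∀ u : ℂ → ℂ,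
      IsDecomposable R₁ R₂ G H u → ∀ M K : ℝ, 0 ≤ M → 0 ≤ K →
      (∀ x ∈ openAnnulus R₁ R₂, ‖u x‖ ≤ M) →
      (∀ x ∈ openAnnulus R₁ R₂, ∀ y ∈ openAnnulus R₁ R₂, ‖u x - u y‖ ≤ K * ‖x - y‖ ^ β) →
      ∀ (a z : ℂ) (ρ : ℝ), R₁ < ρ - ‖a‖ → ρ + ‖a‖ < R₂ → ‖z - a‖ < ρ → z ≠ a →
        ‖G (z, conj a + ρ ^ 2 / (z - a))‖ ≤ K₀ * (M + K) := by
  set J := ∫ θ in -Real.pi..Real.pi, (R₁ * (2 / Real.pi) * |θ|) ^ (β - 1) with hJ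
  have hJ0 : 0 ≤ J := intervalIntegral.integral_nonneg (by linarith [Real.pi_pos]) fun θ _ => by
    have := Real.pi_pos
    positivity
  set D := (2 * R₂) ^ (1 - β) with hD
  have hD0 : 0 ≤ D := by positivity
  refine ⟨R₂ + 2 * R₂ * (R₂ + D) * J, by positivity, ?_⟩
  intro G hG H hH u hu M K hM hK huM huK a z ρ h1 h2 hz hza
  have ha := norm_nonneg a
  have hρ : 0 < ρ := by linarith
  have hmem : ∀ ζ ∈ Metric.sphere a ρ, ζ ∈ openAnnulus R₁ R₂ :=
    fun ζ hζ => sphere_subset_openAnnulus hρ.le h1 h2 hζ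
  have hv : ∀ ζ ∈ openAnnulus R₁ R₂, ∀ ξ ∈ openAnnulus R₁ R₂,
      ‖conj ζ * u ζ - conj ξ * u ξ‖ ≤ (R₂ + D) * (M + K) * ‖ζ - ξ‖ ^ β := by
    intro ζ hζ ξ hξ
    have hd0 := norm_nonneg (ζ - ξ)
    have hd : ‖ζ - ξ‖ ≤ 2 * R₂ := (norm_sub_le _ _).trans (by linarith [hζ.2, hξ.2])
    have hlin : ‖ζ - ξ‖ ≤ D * ‖ζ - ξ‖ ^ β := by
      calc ‖ζ - ξ‖ = ‖ζ - ξ‖ ^ (1 - β) * ‖ζ - ξ‖ ^ β := by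
            rw [← Real.rpow_add' hd0 (by norm_num), sub_add_cancel, Real.rpow_one]
        _ ≤ D * ‖ζ - ξ‖ ^ β := by
            refine mul_le_mul_of_nonneg_right ?_ (by positivity)
            exact Real.rpow_le_rpow hd0 hd (by linarith)
    have e : conj ζ * u ζ - conj ξ * u ξ = conj ζ * (u ζ - u ξ) + conj (ζ - ξ) * u ξ := by
      rw [map_sub]; ring
    rw [e]
    refine (norm_add_le _ _).trans ?_
    rw [norm_mul, norm_mul, RCLike.norm_conj, RCLike.norm_conj]
    have t1 : ‖ζ‖ * ‖u ζ - u ξ‖ ≤ R₂ * (K * ‖ζ - ξ‖ ^ β) :=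
      mul_le_mul hζ.2.le (huK ζ hζ ξ hξ) (norm_nonneg _) hR₂.le
    have t2 : ‖ζ - ξ‖ * ‖u ξ‖ ≤ D * ‖ζ - ξ‖ ^ β * M :=
      mul_le_mul hlin (huM ξ hξ) (norm_nonneg _) (by positivity)
    have t3 : 0 ≤ R₂ * M * ‖ζ - ξ‖ ^ β := by positivity
    have t4 : 0 ≤ D * K * ‖ζ - ξ‖ ^ β := by positivity
    nlinarith
  have hvM : ∀ ζ ∈ Metric.sphere a ρ, ‖conj ζ * u ζ‖ ≤ R₂ * (M + K) := by
    intro ζ hζ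
    rw [norm_mul, RCLike.norm_conj]
    exact mul_le_mul (hmem ζ hζ).2.le ((huM ζ (hmem ζ hζ)).trans (by linarith)) (norm_nonneg _)
      hR₂.le
  have huc : ContinuousOn u (Metric.sphere a ρ) := by
    have hne : ∀ ζ ∈ Metric.sphere a ρ, ζ ≠ 0 := fun ζ hζ =>
      norm_pos_iff.1 (hR₁.trans (hmem ζ hζ).1)
    have hnec : ∀ ζ ∈ Metric.sphere a ρ, conj ζ ≠ 0 := fun ζ hζ => by simpa using hne ζ hζ
    have hcc := Complex.continuous_conj.continuousOn (s := Metric.sphere a ρ)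
    refine ContinuousOn.congr ?_ fun ζ hζ => hu ζ (hmem ζ hζ)
    refine ((hcc.inv₀ hnec).mul ?_).add ((continuousOn_id.inv₀ hne).mul ?_)
    · exact (differentiableOn_of_mem_invPolynomial hG).continuousOn.comp
        (continuousOn_id.prodMk hcc) hnec
    · exact (differentiableOn_of_mem_invPolynomial hH).continuousOn.comp
        (hcc.prodMk continuousOn_id) hne
  rw [← hu.circleAverage_eq hR₁.le hG hH h1 h2 hz hza]
  refine (norm_circleAverage_cauchy_le (R₁ := R₁) (R₂ := R₂) hR₁ (by linarith) (by linarith)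
    hβ hβ1 hz
    (K := (R₂ + D) * (M + K)) (by positivity) (Complex.continuous_conj.continuousOn.mul huc) hvM
    fun ζ hζ ξ hξ => hv ζ (hmem ζ hζ) ξ (hmem ξ hξ)).trans_eq ?_
  rw [← hJ]
  ring

/-! ### The sets `Ω⁺` and `Ω⁻` of an annulus -/

theorem interior_closedAnnulus {r₁ r₂ : ℝ} (hr₁ : 0 < r₁) (hr₂ : 0 < r₂) :
    interior (closedAnnulus r₁ r₂) = openAnnulus r₁ r₂ := by
  have e : closedAnnulus r₁ r₂ = Metric.closedBall 0 r₂ ∩ (Metric.ball 0 r₁)ᶜ := by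
    ext z
    simp [closedAnnulus, and_comm]
  rw [e, interior_inter, interior_compl, closure_ball _ hr₁.ne', interior_closedBall _ hr₂.ne']
  ext z
  simp [openAnnulus, and_comm]

theorem sphere_subset_openAnnulus_iff {R₁ R₂ ρ : ℝ} {a : ℂ} (ha : ‖a‖ < ρ) :
    Metric.sphere a ρ ⊆ openAnnulus R₁ R₂ ↔ R₁ < ρ - ‖a‖ ∧ ρ + ‖a‖ < R₂ := by
  have hρ : 0 < ρ := (norm_nonneg a).trans_lt ha
  refine ⟨fun h => ?_, fun h => sphere_subset_openAnnulus hρ.le h.1 h.2⟩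
  -- The points of the circle on the line through the origin and `a`.
  obtain ⟨e, he, hea⟩ : ∃ e : ℂ, ‖e‖ = 1 ∧ a = ‖a‖ * e :=
    ⟨Complex.exp (a.arg * Complex.I), Complex.norm_exp_ofReal_mul_I _,
      (Complex.norm_mul_exp_arg_mul_I a).symm⟩
  have hmem : ∀ t : ℝ, |t| = ρ → a + t * e ∈ openAnnulus R₁ R₂ := by
    intro t ht
    refine h ?_
    rw [Metric.mem_sphere, dist_eq_norm, add_sub_cancel_left, norm_mul, he, mul_one,
      Complex.norm_real, Real.norm_eq_abs, ht]
  have hnorm : ∀ t : ℝ, ‖a + t * e‖ = |‖a‖ + t| := by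
    intro t
    have : a + t * e = ((‖a‖ + t : ℝ) : ℂ) * e := by
      conv_lhs => rw [hea]
      push_cast
      ring
    rw [this, norm_mul, he, mul_one, Complex.norm_real, Real.norm_eq_abs]
  have h1 := (hmem (-ρ) (by rw [abs_neg, abs_of_pos hρ])).1
  have h2 := (hmem ρ (abs_of_pos hρ)).2
  rw [hnorm, abs_of_neg (by linarith)] at h1
  rw [hnorm, abs_of_pos (by linarith [norm_nonneg a])] at h2
  constructor <;> linarith

theorem mem_omegaPlus_iff {r₁ r₂ : ℝ} (hr₁ : 0 < r₁) (hr₂ : 0 < r₂) {p : ℂ × ℂ} :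
    p ∈ omegaPlus (closedAnnulus r₁ r₂) ↔
      ∃ (a : ℂ) (ρ : ℝ), r₁ < ρ - ‖a‖ ∧ ρ + ‖a‖ < r₂ ∧ p ∈ lambdaPlus a ρ := by
  rw [omegaPlus, interior_closedAnnulus hr₁ hr₂]
  refine exists_congr fun a => exists_congr fun ρ => ?_
  have h0 : CircleSurroundsOrigin a ρ ↔ ‖a‖ < ρ := by simp [CircleSurroundsOrigin]
  rw [h0]
  constructor
  · rintro ⟨h1, h2, h3⟩
    obtain ⟨h4, h5⟩ := (sphere_subset_openAnnulus_iff h2).1 h1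
    exact ⟨h4, h5, h3⟩
  · rintro ⟨h1, h2, h3⟩
    have h4 : ‖a‖ < ρ := by linarith
    exact ⟨(sphere_subset_openAnnulus_iff h4).2 ⟨h1, h2⟩, h4, h3⟩

theorem lambdaMinus_eq_preimage_swap {a : ℂ} {ρ : ℝ} (hρ : 0 < ρ) {p : ℂ × ℂ} :
    p ∈ lambdaMinus a ρ ↔ p.swap ∈ lambdaPlus (conj a) ρ := by
  simp only [lambdaMinus, lambdaPlus, Set.mem_ofPred_eq, Prod.fst_swap, Prod.snd_swap,
    Complex.conj_conj]
  rw [mul_comm (p.2 - conj a)]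
  refine and_congr_right fun h => ?_
  have h1 : ‖p.1 - a‖ * ‖p.2 - conj a‖ = ρ ^ 2 := by
    rw [← norm_mul, h, norm_pow, Complex.norm_real, Real.norm_eq_abs, sq_abs]
  have hx := norm_nonneg (p.1 - a)
  have hy := norm_nonneg (p.2 - conj a)
  constructor
  · intro h2
    have hy0 : 0 < ‖p.2 - conj a‖ := by
      by_contra hcon
      rw [le_antisymm (not_lt.1 hcon) hy, mul_zero] at h1
      nlinarith
    exact ⟨hy0, by nlinarith⟩
  · rintro ⟨h2, h3⟩
    nlinarith

/-- Exchanging the coordinates exchanges `Ω⁺` and `Ω⁻`, because the annulus is symmetric under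
conjugation. -/
theorem omegaMinus_eq_preimage_swap {r₁ r₂ : ℝ} (hr₁ : 0 < r₁) (hr₂ : 0 < r₂) :
    omegaMinus (closedAnnulus r₁ r₂) = Prod.swap ⁻¹' omegaPlus (closedAnnulus r₁ r₂) := by
  ext p
  rw [Set.mem_preimage, mem_omegaPlus_iff hr₁ hr₂, omegaMinus, interior_closedAnnulus hr₁ hr₂]
  have h0 : ∀ (a : ℂ) (ρ : ℝ), CircleSurroundsOrigin a ρ ↔ ‖a‖ < ρ := by
    simp [CircleSurroundsOrigin]
  constructor
  · rintro ⟨a, ρ, h1, h2, h3⟩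
    rw [h0] at h2
    obtain ⟨h4, h5⟩ := (sphere_subset_openAnnulus_iff h2).1 h1
    exact ⟨conj a, ρ, by simpa using h4, by simpa using h5,
      (lambdaMinus_eq_preimage_swap ((norm_nonneg a).trans_lt h2)).1 h3⟩
  · rintro ⟨a, ρ, h1, h2, h3⟩
    have h4 : ‖conj a‖ < ρ := by
      rw [RCLike.norm_conj]
      linarith
    refine ⟨conj a, ρ, (sphere_subset_openAnnulus_iff h4).2 ⟨by simpa using h1, by simpa using h2⟩,
      (h0 _ _).2 h4, (lambdaMinus_eq_preimage_swap ((norm_nonneg _).trans_lt h4)).2 ?_⟩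
    rwa [Complex.conj_conj]

/-- The condition that the curve of the circle with centre `a` and some real squared radius passes
through `(z, w)` is linear in `a`, namely `Im (z w) = Im (a (w - z̄))`. A solution is therefore
found close to a given centre when `(z, w)` moves. -/
theorem isOpen_omegaPlus {r₁ r₂ : ℝ} (hr₁ : 0 < r₁) (hr₂ : 0 < r₂) :
    IsOpen (omegaPlus (closedAnnulus r₁ r₂)) := by
  rw [isOpen_iff_mem_nhds]
  rintro ⟨z₀, w₀⟩ hp
  obtain ⟨a, ρ, h1, h2, h3, h4, h5⟩ := (mem_omegaPlus_iff hr₁ hr₂).1 hp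
  simp only at h3 h4 h5
  have hρ : 0 < ρ := by linarith [norm_nonneg a]
  set d : ℂ × ℂ → ℂ := fun p => p.2 - conj p.1 with hd
  set s : ℂ × ℂ → ℝ := fun p => ((p.1 * p.2).im - (a * d p).im) / Complex.normSq (d p) with hs
  set a' : ℂ × ℂ → ℂ := fun p => a + Complex.I * s p * conj (d p) with ha'
  set R : ℂ × ℂ → ℝ := fun p => ((p.1 - a' p) * (p.2 - conj (a' p))).re with hR
  have hd0 : d (z₀, w₀) ≠ 0 := by
    intro h0
    simp only [hd, sub_eq_zero] at h0
    rw [h0, ← map_sub, Complex.mul_conj, Complex.normSq_eq_norm_sq] at h3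
    have h6 : ‖z₀ - a‖ ^ 2 = ρ ^ 2 := by exact_mod_cast h3
    nlinarith
  have hs0 : s (z₀, w₀) = 0 := by
    have h6 : ((z₀ - a) * (w₀ - conj a)).im = 0 := by
      rw [h3, ← Complex.ofReal_pow]
      exact Complex.ofReal_im _
    have h7 : (z₀ * w₀).im - (a * d (z₀, w₀)).im = ((z₀ - a) * (w₀ - conj a)).im := by
      simp [hd]
      ring
    simp only [hs]
    rw [h7, h6, zero_div]
  have ha0 : a' (z₀, w₀) = a := by simp [ha', hs0]
  have hR0 : R (z₀, w₀) = ρ ^ 2 := by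
    simp only [hR]
    rw [ha0, h3, ← Complex.ofReal_pow]
    exact Complex.ofReal_re _
  have hdc : Continuous d := by fun_prop
  have hsc : ContinuousAt s (z₀, w₀) := by
    refine ContinuousAt.div ?_ ?_ (by simpa using hd0)
    · exact ((Complex.continuous_im.comp (by fun_prop)).sub
        (Complex.continuous_im.comp (by fun_prop))).continuousAt
    · exact (Complex.continuous_normSq.comp hdc).continuousAt
  have hac : ContinuousAt a' (z₀, w₀) := by
    refine continuousAt_const.add ((continuousAt_const.mul ?_).mul ?_)
    · exact Complex.continuous_ofReal.continuousAt.comp hsc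
    · exact (Complex.continuous_conj.comp hdc).continuousAt
  have hRc : ContinuousAt R (z₀, w₀) := by
    refine Complex.continuous_re.continuousAt.comp
      ((continuousAt_fst.sub hac).mul (continuousAt_snd.sub ?_))
    exact Complex.continuous_conj.continuousAt.comp hac
  have hrad : ContinuousAt (fun p => √(R p)) (z₀, w₀) := Real.continuous_sqrt.continuousAt.comp hRc
  have hrad0 : √(R (z₀, w₀)) = ρ := by rw [hR0, Real.sqrt_sq hρ.le]
  have e1 : ∀ᶠ p in 𝓝 (z₀, w₀), 0 < R p :=
    continuousAt_const.eventually_lt hRc (by rw [hR0]; positivity)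
  have e2 : ∀ᶠ p in 𝓝 (z₀, w₀), r₁ < √(R p) - ‖a' p‖ :=
    continuousAt_const.eventually_lt (hrad.sub hac.norm) (by
      change r₁ < √(R (z₀, w₀)) - ‖a' (z₀, w₀)‖
      rwa [hrad0, ha0])
  have e3 : ∀ᶠ p in 𝓝 (z₀, w₀), √(R p) + ‖a' p‖ < r₂ :=
    (hrad.add hac.norm).eventually_lt continuousAt_const (by
      change √(R (z₀, w₀)) + ‖a' (z₀, w₀)‖ < r₂
      rwa [hrad0, ha0])
  have e4 : ∀ᶠ p in 𝓝 (z₀, w₀), 0 < ‖p.1 - a' p‖ :=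
    continuousAt_const.eventually_lt (continuousAt_fst.sub hac).norm (by
      change 0 < ‖z₀ - a' (z₀, w₀)‖
      rwa [ha0])
  have e5 : ∀ᶠ p in 𝓝 (z₀, w₀), ‖p.1 - a' p‖ < √(R p) :=
    (continuousAt_fst.sub hac).norm.eventually_lt hrad (by
      change ‖z₀ - a' (z₀, w₀)‖ < √(R (z₀, w₀))
      rwa [hrad0, ha0])
  have e6 : ∀ᶠ p in 𝓝 (z₀, w₀), d p ≠ 0 := hdc.continuousAt.eventually_ne hd0
  filter_upwards [e1, e2, e3, e4, e5, e6] with p f1 f2 f3 f4 f5 f6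
  refine (mem_omegaPlus_iff hr₁ hr₂).2 ⟨a' p, √(R p), f2, f3, ?_, f4, f5⟩
  rw [← Complex.ofReal_pow, Real.sq_sqrt f1.le]
  refine Complex.ext (by rw [Complex.ofReal_re]) ?_
  rw [Complex.ofReal_im]
  have hN : Complex.normSq (d p) ≠ 0 := by simpa using f6
  have h7 : ((p.1 - a' p) * (p.2 - conj (a' p))).im = (p.1 * p.2).im - (a' p * d p).im := by
    simp [hd]
    ring
  have h8 : (a' p * d p).im = (a * d p).im + s p * Complex.normSq (d p) := by
    have : a' p * d p = a * d p + ((s p * Complex.normSq (d p) : ℝ) : ℂ) * Complex.I := by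
      simp only [ha']
      push_cast
      rw [← Complex.mul_conj]
      ring
    rw [this, Complex.add_im, Complex.im_ofReal_mul, Complex.I_im, mul_one]
  rw [h7, h8]
  simp only [hs]
  rw [div_mul_cancel₀ _ hN]
  ring

theorem closure_omegaPlus_subset {r₁ r₂ : ℝ} (hr₁ : 0 < r₁) (hr₂ : 0 < r₂) :
    closure (omegaPlus (closedAnnulus r₁ r₂)) ⊆ {p | ‖p.1‖ ≤ r₂ ∧ r₁ ≤ ‖p.2‖} := by
  refine closure_minimal ?_ ((isClosed_le continuous_fst.norm continuous_const).inter
    (isClosed_le continuous_const continuous_snd.norm))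
  intro p hp
  obtain ⟨a, ρ, h1, h2, h3, h4, h5⟩ := (mem_omegaPlus_iff hr₁ hr₂).1 hp
  have hρ : 0 < ρ := by linarith [norm_nonneg a]
  constructor
  · have := norm_add_le (p.1 - a) a
    rw [sub_add_cancel] at this
    linarith
  · have e : ‖p.1 - a‖ * ‖p.2 - conj a‖ = ρ ^ 2 := by
      rw [← norm_mul, h3, norm_pow, Complex.norm_real, Real.norm_eq_abs, sq_abs]
    have h6 : ρ ≤ ‖p.2 - conj a‖ := by
      by_contra hcon
      nlinarith [norm_nonneg (p.2 - conj a)]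
    have h7 := norm_sub_le p.2 (conj a)
    rw [RCLike.norm_conj] at h7
    linarith

theorem closedAnnulus_subset_closure {r₁ r₂ : ℝ} (hr₁ : 0 < r₁) (hr : r₁ < r₂) :
    closedAnnulus r₁ r₂ ⊆ closure (openAnnulus r₁ r₂) := by
  intro z hz
  have hn : 0 < ‖z‖ := hr₁.trans_le hz.1
  have hc : Continuous fun s : ℝ => ((s / ‖z‖ : ℝ) : ℂ) * z := by fun_prop
  have h1 : ‖z‖ ∈ closure (Set.Ioo r₁ r₂) := by
    rw [closure_Ioo hr.ne]
    exact hz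
  have h2 := image_closure_subset_closure_image hc ⟨_, h1, rfl⟩
  simp only [div_self hn.ne', Complex.ofReal_one, one_mul] at h2
  refine closure_mono ?_ h2
  rintro _ ⟨s, hs, rfl⟩
  have : ‖((s / ‖z‖ : ℝ) : ℂ) * z‖ = s := by
    rw [norm_mul, Complex.norm_real, Real.norm_eq_abs,
      abs_of_pos (div_pos (hr₁.trans hs.1) hn), div_mul_cancel₀ _ hn.ne']
  change _ < _ ∧ _ < _
  rw [this]
  exact hs

theorem mem_closure_omegaPlus {r₁ r₂ : ℝ} (hr₁ : 0 < r₁) (hr : r₁ < r₂) {z : ℂ}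
    (hz : z ∈ closedAnnulus r₁ r₂) : (z, conj z) ∈ closure (omegaPlus (closedAnnulus r₁ r₂)) := by
  have hr₂ := hr₁.trans hr
  have hopen : ∀ z ∈ openAnnulus r₁ r₂,
      (z, conj z) ∈ closure (omegaPlus (closedAnnulus r₁ r₂)) := by
    intro z hz
    have hn : 0 < ‖z‖ := hr₁.trans hz.1
    -- These points lie on the curve of the circle through `z` centred at the origin.
    have hlim : Tendsto (fun t : ℝ => ((t : ℂ) * z, (t : ℂ)⁻¹ * conj z)) (𝓝[<] 1)
        (𝓝 (z, conj z)) := by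
      have hc : ContinuousAt (fun t : ℝ => ((t : ℂ) * z, (t : ℂ)⁻¹ * conj z)) 1 := by
        have h1 := Complex.continuous_ofReal.continuousAt (x := (1 : ℝ))
        exact (h1.mul continuousAt_const).prodMk
          ((h1.inv₀ (by simp)).mul continuousAt_const)
      have := hc.tendsto
      simp only [Complex.ofReal_one, one_mul, inv_one] at this
      exact this.mono_left nhdsWithin_le_nhds
    refine mem_closure_of_tendsto hlim ?_
    filter_upwards [Ioo_mem_nhdsLT (zero_lt_one (α := ℝ))] with t ht
    have ht0 : (t : ℂ) ≠ 0 := by exact_mod_cast ht.1.ne'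
    have hnt : ‖(t : ℂ) * z‖ = t * ‖z‖ := by
      rw [norm_mul, Complex.norm_real, Real.norm_of_nonneg ht.1.le]
    refine (mem_omegaPlus_iff hr₁ hr₂).2 ⟨0, ‖z‖, by simpa using hz.1, by simpa using hz.2,
      ?_, ?_, ?_⟩
    · simp only [sub_zero, map_zero]
      rw [mul_mul_mul_comm, mul_inv_cancel₀ ht0, one_mul, Complex.mul_conj,
        Complex.normSq_eq_norm_sq]
      push_cast
      rfl
    · simp only [sub_zero]
      rw [hnt]
      exact mul_pos ht.1 hn
    · simp only [sub_zero]
      rw [hnt]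
      nlinarith [ht.2]
  have hc : Continuous fun z : ℂ => (z, conj z) :=
    continuous_id.prodMk Complex.continuous_conj
  have h := image_closure_subset_closure_image hc ⟨z, closedAnnulus_subset_closure hr₁ hr hz, rfl⟩
  refine closure_minimal ?_ isClosed_closure h
  rintro _ ⟨z, hz, rfl⟩
  exact hopen z hz

/-! ### Uniform limits of holomorphic functions and the decomposition -/

/-- Cauchy's estimate for the derivative of a holomorphic function on a normed space, obtained from
the one-dimensional estimate on complex lines. -/
theorem norm_fderiv_le_of_forall_mem_ball {E : Type*} [NormedAddCommGroup E] [NormedSpace ℂ E]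
    {f : E → ℂ} {x : E} {R C : ℝ} (hR : 0 < R) (hC : 0 ≤ C)
    (hf : DifferentiableOn ℂ f (Metric.ball x R)) (hfC : ∀ y ∈ Metric.ball x R, ‖f y‖ ≤ C) :
    ‖fderiv ℂ f x‖ ≤ C / (R / 2) := by
  refine ContinuousLinearMap.opNorm_le_bound _ (by positivity) fun v => ?_
  rcases eq_or_ne v 0 with rfl | hv
  · simp
  have hv0 : 0 < ‖v‖ := norm_pos_iff.2 hv
  have hr : 0 < R / 2 / ‖v‖ := by positivity
  have hline : ∀ c ∈ Metric.closedBall (0 : ℂ) (R / 2 / ‖v‖), x + c • v ∈ Metric.ball x R := by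
    intro c hc
    rw [mem_closedBall_zero_iff, le_div_iff₀ hv0] at hc
    rw [Metric.mem_ball, dist_eq_norm, add_sub_cancel_left, norm_smul]
    linarith
  have hd : DifferentiableOn ℂ (fun c : ℂ => f (x + c • v))
      (Metric.closedBall 0 (R / 2 / ‖v‖)) := hf.comp (by fun_prop) hline
  have h1 := Complex.norm_deriv_le_of_forall_mem_sphere_norm_le hr
    (hd.diffContOnCl_ball subset_rfl) fun c hc =>
      hfC _ (hline c (Metric.sphere_subset_closedBall hc))
  have h2 : HasDerivAt (fun c : ℂ => f (x + c • v)) (fderiv ℂ f x v) 0 := by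
    have h3 : HasDerivAt (fun c : ℂ => x + c • v) v 0 := by
      simpa using ((hasDerivAt_id (0 : ℂ)).smul_const v).const_add x
    have h4 : HasFDerivAt f (fderiv ℂ f x) (x + (0 : ℂ) • v) := by
      rw [zero_smul, add_zero]
      exact ((hf x (Metric.mem_ball_self hR)).differentiableAt
        (Metric.ball_mem_nhds x hR)).hasFDerivAt
    exact h4.comp_hasDerivAt (0 : ℂ) h3
  rw [h2.deriv] at h1
  refine h1.trans_eq ?_
  field_simp

/-- A uniform limit of holomorphic functions on an open set of a normed space is holomorphic. -/
theorem differentiableOn_of_uniformCauchySeqOn {E : Type*} [NormedAddCommGroup E] [NormedSpace ℂ E]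
    {G : ℕ → E → ℂ} {g : E → ℂ} {Ω : Set E} (hΩ : IsOpen Ω)
    (hd : ∀ n, DifferentiableOn ℂ (G n) Ω) (hU : UniformCauchySeqOn G atTop Ω)
    (hg : ∀ x ∈ Ω, Tendsto (fun n => G n x) atTop (𝓝 (g x))) : DifferentiableOn ℂ g Ω := by
  intro x hx
  obtain ⟨R, hR, hball⟩ := Metric.isOpen_iff.1 hΩ x hx
  have hsub : ∀ y ∈ Metric.ball x (R / 2), Metric.ball y (R / 2) ⊆ Ω := fun y hy =>
    (Metric.ball_subset_ball' (by rw [Metric.mem_ball] at hy; linarith)).trans hball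
  have hdiff : ∀ n, ∀ y ∈ Metric.ball x (R / 2), DifferentiableAt ℂ (G n) y := fun n y hy =>
    (hd n).differentiableAt (hΩ.mem_nhds (hsub y hy (Metric.mem_ball_self (by linarith))))
  have hC : UniformCauchySeqOn (fun n => fderiv ℂ (G n)) atTop (Metric.ball x (R / 2)) := by
    rw [Metric.uniformCauchySeqOn_iff] at hU ⊢
    intro ε hε
    obtain ⟨N, hN⟩ := hU (ε * (R / 8)) (by positivity)
    refine ⟨N, fun m hm n hn y hy => ?_⟩
    have h1 := norm_fderiv_le_of_forall_mem_ball (f := G m - G n) (x := y) (R := R / 2)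
      (C := ε * (R / 8)) (by positivity) (by positivity)
      (((hd m).mono (hsub y hy)).sub ((hd n).mono (hsub y hy)))
      fun z hz => by
        rw [Pi.sub_apply, ← dist_eq_norm]
        exact (hN m hm n hn z (hsub y hy hz)).le
    rw [fderiv_sub (hdiff m y hy) (hdiff n y hy), ← dist_eq_norm] at h1
    refine h1.trans_lt ?_
    have : ε * (R / 8) / (R / 2 / 2) = ε / 2 := by field_simp; norm_num
    rw [this]
    linarith
  have hlim : ∀ y, ∃ l, y ∈ Metric.ball x (R / 2) →
      Tendsto (fun n => fderiv ℂ (G n) y) atTop (𝓝 l) := by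
    intro y
    by_cases hy : y ∈ Metric.ball x (R / 2)
    · obtain ⟨l, hl⟩ := cauchySeq_tendsto_of_complete (hC.cauchySeq hy)
      exact ⟨l, fun _ => hl⟩
    · exact ⟨0, fun h => absurd h hy⟩
  choose g' hg' using hlim
  have h := hasFDerivAt_of_tendstoUniformlyOn Metric.isOpen_ball
    (hC.tendstoUniformlyOn_of_tendsto hg') (fun n y hy => (hdiff n y hy).hasFDerivAt)
    (fun y hy => hg y (hsub y hy (Metric.mem_ball_self (by linarith))))
    (Metric.mem_ball_self (by linarith : 0 < R / 2))
  exact h.differentiableAt.differentiableWithinAt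

/-- A uniformly Cauchy sequence of holomorphic functions on `Ω` that are continuous and bounded on
the closure converges there to a function with the same properties. -/
theorem exists_isBoundedContHolo_tendsto {Ω : Set (ℂ × ℂ)} (hΩ : IsOpen Ω) {G : ℕ → ℂ × ℂ → ℂ}
    (hd : ∀ n, DifferentiableOn ℂ (G n) Ω) (hc : ∀ n, ContinuousOn (G n) (closure Ω))
    (hb : ∀ n, ∃ M : ℝ, ∀ p ∈ closure Ω, ‖G n p‖ ≤ M) (hU : UniformCauchySeqOn G atTop Ω) :
    ∃ g, IsBoundedContHolo g Ω ∧
      ∀ p ∈ closure Ω, Tendsto (fun n => G n p) atTop (𝓝 (g p)) := by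
  have hUc : UniformCauchySeqOn G atTop (closure Ω) := by
    rw [Metric.uniformCauchySeqOn_iff] at hU ⊢
    intro ε hε
    obtain ⟨N, hN⟩ := hU (ε / 2) (by positivity)
    refine ⟨N, fun m hm n hn p hp => ?_⟩
    refine lt_of_le_of_lt ?_ (half_lt_self hε)
    rw [dist_eq_norm]
    have hcont : ContinuousOn (fun q => ‖G m q - G n q‖) (closure Ω) :=
      ((hc m).sub (hc n)).norm
    refine closure_minimal ?_ isClosed_Iic (hcont.image_closure ⟨p, hp, rfl⟩)
    rintro _ ⟨q, hq, rfl⟩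
    have h := hN m hm n hn q hq
    rw [dist_eq_norm] at h
    exact h.le
  have hlim : ∀ p, ∃ l, p ∈ closure Ω → Tendsto (fun n => G n p) atTop (𝓝 l) := by
    intro p
    by_cases hp : p ∈ closure Ω
    · obtain ⟨l, hl⟩ := cauchySeq_tendsto_of_complete (hUc.cauchySeq hp)
      exact ⟨l, fun _ => hl⟩
    · exact ⟨0, fun h => absurd h hp⟩
  choose g hg using hlim
  have hunif := hUc.tendstoUniformlyOn_of_tendsto hg
  refine ⟨g, ⟨hunif.continuousOn (Frequently.of_forall hc), ?_,
    differentiableOn_of_uniformCauchySeqOn hΩ hd hU fun p hp => hg p (subset_closure hp)⟩, hg⟩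
  obtain ⟨N, hN⟩ := (Metric.tendstoUniformlyOn_iff.1 hunif 1 one_pos).exists
  obtain ⟨M, hM⟩ := hb N
  refine ⟨M + 1, fun p hp => ?_⟩
  have h1 := hN p hp
  rw [dist_eq_norm] at h1
  have h2 := norm_add_le (g p - G N p) (G N p)
  rw [sub_add_cancel] at h2
  linarith [hM p hp]

theorem exists_norm_le_of_mem_invPolynomial {G : ℂ × ℂ → ℂ} (hG : G ∈ invPolynomial) {r₁ r₂ : ℝ}
    (hr₁ : 0 < r₁) : ∃ M : ℝ, ∀ p : ℂ × ℂ, ‖p.1‖ ≤ r₂ → r₁ ≤ ‖p.2‖ → ‖G p‖ ≤ M := by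
  induction hG using Submodule.span_induction with
  | mem G hG =>
    obtain ⟨⟨k, l⟩, rfl⟩ := hG
    refine ⟨r₂ ^ k * r₁⁻¹ ^ l, fun p h1 h2 => ?_⟩
    simp only [norm_mul, norm_pow, norm_inv]
    have := (norm_nonneg p.1).trans h1
    gcongr
  | zero => exact ⟨0, fun p _ _ => by simp⟩
  | add G G' _ _ h h' =>
    obtain ⟨M, hM⟩ := h
    obtain ⟨M', hM'⟩ := h'
    exact ⟨M + M', fun p h1 h2 => (norm_add_le _ _).trans (add_le_add (hM p h1 h2) (hM' p h1 h2))⟩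
  | smul c G _ h =>
    obtain ⟨M, hM⟩ := h
    refine ⟨‖c‖ * M, fun p h1 h2 => ?_⟩
    rw [Pi.smul_apply, norm_smul]
    exact mul_le_mul_of_nonneg_left (hM p h1 h2) (norm_nonneg c)

theorem IsDecomposable.sub {R₁ R₂ : ℝ} {G H G' H' : ℂ × ℂ → ℂ} {u v : ℂ → ℂ}
    (hu : IsDecomposable R₁ R₂ G H u) (hv : IsDecomposable R₁ R₂ G' H' v) :
    IsDecomposable R₁ R₂ (G - G') (H - H') (u - v) := by
  intro z hz
  simp only [Pi.sub_apply, hu z hz, hv z hz]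
  ring

theorem IsDecomposable.comp_conj {R₁ R₂ : ℝ} {G H : ℂ × ℂ → ℂ} {u : ℂ → ℂ}
    (hu : IsDecomposable R₁ R₂ G H u) : IsDecomposable R₁ R₂ H G (fun z => u (conj z)) := by
  intro z hz
  have h := hu (conj z) (by simpa [openAnnulus] using hz)
  rw [Complex.conj_conj] at h
  exact h.trans (add_comm _ _)

theorem norm_le_two_mul_sqrt_mul_rpow_half {d : ℂ} {M C α t : ℝ} (hM : 0 ≤ M) (hC : 0 ≤ C)
    (ht : 0 ≤ t) (h1 : ‖d‖ ≤ 2 * M) (h2 : ‖d‖ ≤ 2 * (C * t ^ α)) :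
    ‖d‖ ≤ 2 * √(M * C) * t ^ (α / 2) := by
  refine abs_le_of_sq_le_sq' ?_ (by positivity) |>.2
  have e : (2 * √(M * C) * t ^ (α / 2)) ^ 2 = (2 * M) * (2 * (C * t ^ α)) := by
    have h3 : (t ^ (α / 2)) ^ 2 = t ^ α := by
      rw [← Real.rpow_mul_natCast ht, Nat.cast_ofNat, div_mul_cancel₀ _ two_ne_zero]
    rw [mul_pow, mul_pow, Real.sq_sqrt (by positivity), h3]
    ring
  rw [e, sq]
  exact mul_le_mul h1 h2 (norm_nonneg _) (by positivity)

/-- If decomposable functions with a common Hölder bound converge uniformly on the annulus, then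
the parts `G` of their decompositions converge uniformly on `Ω⁺`. The differences are small in the
norm of half the Hölder exponent, by interpolation. -/
theorem uniformCauchySeqOn_omegaPlus {r₁ r₂ : ℝ} (hr₁ : 0 < r₁) (hr₂ : 0 < r₂) {F : ℂ → ℂ}
    {u : ℕ → ℂ → ℂ} {G H : ℕ → ℂ × ℂ → ℂ} (hG : ∀ n, G n ∈ invPolynomial)
    (hH : ∀ n, H n ∈ invPolynomial) (hu : ∀ n, IsDecomposable r₁ r₂ (G n) (H n) (u n)) {C α : ℝ}
    (hC : 0 ≤ C) (hα : 0 < α) (hα1 : α ≤ 1)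
    (hold : ∀ n, ∀ x ∈ openAnnulus r₁ r₂, ∀ y ∈ openAnnulus r₁ r₂,
      ‖u n x - u n y‖ ≤ C * ‖x - y‖ ^ α)
    (hF : TendstoUniformlyOn u F atTop (openAnnulus r₁ r₂)) :
    UniformCauchySeqOn G atTop (omegaPlus (closedAnnulus r₁ r₂)) := by
  obtain ⟨K₀, hK₀, hest⟩ := exists_norm_le_of_isDecomposable (β := α / 2) hr₁ hr₂ (by linarith)
    (by linarith)
  have hUC := hF.uniformCauchySeqOn
  rw [Metric.uniformCauchySeqOn_iff] at hUC ⊢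
  intro ε hε
  obtain ⟨δ, hδ, hδε⟩ : ∃ δ > 0, K₀ * (δ + 2 * √(δ * C)) < ε := by
    have hc : Continuous fun δ : ℝ => K₀ * (δ + 2 * √(δ * C)) := by fun_prop
    have hev : ∀ᶠ δ in 𝓝[>] (0 : ℝ), K₀ * (δ + 2 * √(δ * C)) < ε :=
      (hc.tendsto' 0 0 (by simp)).mono_left nhdsWithin_le_nhds |>.eventually_lt_const hε
    obtain ⟨δ, h1, h2⟩ := (hev.and self_mem_nhdsWithin).exists
    exact ⟨δ, h2, h1⟩
  obtain ⟨N, hN⟩ := hUC δ hδ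
  refine ⟨N, fun m hm n hn p hp => ?_⟩
  obtain ⟨a, ρ, h1, h2, h3, h4, h5⟩ := (mem_omegaPlus_iff hr₁ hr₂).1 hp
  have hza : p.1 - a ≠ 0 := norm_pos_iff.1 h4
  have hp2 : p = (p.1, conj a + (ρ : ℂ) ^ 2 / (p.1 - a)) := by
    refine Prod.ext rfl ?_
    rw [← h3, mul_div_cancel_left₀ _ hza]
    ring
  have hsup : ∀ x ∈ openAnnulus r₁ r₂, ‖(u m - u n) x‖ ≤ δ := fun x hx => by
    rw [Pi.sub_apply, ← dist_eq_norm]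
    exact (hN m hm n hn x hx).le
  have key := hest (G m - G n) (sub_mem (hG m) (hG n)) (H m - H n) (sub_mem (hH m) (hH n))
    (u m - u n) ((hu m).sub (hu n)) δ (2 * √(δ * C)) hδ.le (by positivity) hsup
    (fun x hx y hy => by
      refine norm_le_two_mul_sqrt_mul_rpow_half hδ.le hC (norm_nonneg _) ?_ ?_
      · exact (norm_sub_le _ _).trans (by linarith [hsup x hx, hsup y hy])
      · have e : (u m - u n) x - (u m - u n) y = (u m x - u m y) - (u n x - u n y) := by
          simp only [Pi.sub_apply]; ring
        rw [e]
        exact (norm_sub_le _ _).trans (by linarith [hold m x hx y hy, hold n x hx y hy]))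
    a p.1 ρ h1 h2 h5 (sub_ne_zero.1 hza)
  rw [← hp2] at key
  rw [dist_eq_norm]
  exact key.trans_lt hδε

theorem exists_isBoundedContHolo_tendsto_of_isDecomposable {r₁ r₂ : ℝ} (hr₁ : 0 < r₁)
    (hr₂ : 0 < r₂) {F : ℂ → ℂ}
    {u : ℕ → ℂ → ℂ} {G H : ℕ → ℂ × ℂ → ℂ} (hG : ∀ n, G n ∈ invPolynomial)
    (hH : ∀ n, H n ∈ invPolynomial) (hu : ∀ n, IsDecomposable r₁ r₂ (G n) (H n) (u n)) {C α : ℝ}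
    (hC : 0 ≤ C) (hα : 0 < α) (hα1 : α ≤ 1)
    (hold : ∀ n, ∀ x ∈ openAnnulus r₁ r₂, ∀ y ∈ openAnnulus r₁ r₂,
      ‖u n x - u n y‖ ≤ C * ‖x - y‖ ^ α)
    (hF : TendstoUniformlyOn u F atTop (openAnnulus r₁ r₂)) :
    ∃ g, IsBoundedContHolo g (omegaPlus (closedAnnulus r₁ r₂)) ∧
      ∀ p ∈ closure (omegaPlus (closedAnnulus r₁ r₂)),
        Tendsto (fun n => G n p) atTop (𝓝 (g p)) := by
  have hsub := closure_omegaPlus_subset hr₁ hr₂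
  have hne : closure (omegaPlus (closedAnnulus r₁ r₂)) ⊆ {p | p.2 ≠ 0} := fun p hp =>
    norm_pos_iff.1 (hr₁.trans_le (hsub hp).2)
  refine exists_isBoundedContHolo_tendsto (isOpen_omegaPlus hr₁ hr₂)
    (fun n => (differentiableOn_of_mem_invPolynomial (hG n)).mono (subset_closure.trans hne))
    (fun n => (differentiableOn_of_mem_invPolynomial (hG n)).continuousOn.mono hne)
    (fun n => ?_) (uniformCauchySeqOn_omegaPlus hr₁ hr₂ hG hH hu hC hα hα1 hold hF)
  obtain ⟨M, hM⟩ := exists_norm_le_of_mem_invPolynomial (hG n) (r₂ := r₂) hr₁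
  exact ⟨M, fun p hp => hM p (hsub hp).1 (hsub hp).2⟩

theorem IsBoundedContHolo.comp_swap {g : ℂ × ℂ → ℂ} {Ω : Set (ℂ × ℂ)}
    (h : IsBoundedContHolo g Ω) : IsBoundedContHolo (fun p => g p.swap) (Prod.swap ⁻¹' Ω) := by
  have hcl : closure (Prod.swap ⁻¹' Ω) = Prod.swap ⁻¹' closure Ω :=
    ((Homeomorph.prodComm ℂ ℂ).preimage_closure Ω).symm
  obtain ⟨h1, ⟨M, hM⟩, h3⟩ := h
  rw [IsBoundedContHolo, hcl]
  refine ⟨h1.comp continuous_swap.continuousOn fun p hp => hp, ⟨M, fun p hp => hM _ hp⟩, ?_⟩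
  exact h3.comp (differentiable_snd.prodMk differentiable_fst).differentiableOn fun p hp => hp

theorem theorem1p2 (r₁ r₂ : ℝ) (hr₁ : 0 < r₁) (hr₁₂ : r₁ < r₂) (f : ℂ → ℂ)
    (hf : IsHolderContinuousOn f (closedAnnulus r₁ r₂))
    (hmean : ∀ (a : ℂ) (ρ : ℝ), Metric.sphere a ρ ⊆ closedAnnulus r₁ r₂ →
      CircleSurroundsOrigin a ρ → Real.circleAverage f a ρ = 0) :
    ∃ Gp Gm : ℂ × ℂ → ℂ,
      IsBoundedContHolo Gp (omegaPlus (closedAnnulus r₁ r₂)) ∧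
      IsBoundedContHolo Gm (omegaMinus (closedAnnulus r₁ r₂)) ∧
      ∀ z ∈ closedAnnulus r₁ r₂,
        f z = (1 / conj z) * Gp (z, conj z) + (1 / z) * Gm (z, conj z) := by
  have hr₂ := hr₁.trans hr₁₂
  obtain ⟨C, α, hα, hα1, hold⟩ := hf
  have hfc : ContinuousOn f (closedAnnulus r₁ r₂) := hold.continuousOn hα
  have hclosed : IsClosed (closedAnnulus r₁ r₂) :=
    (isClosed_le continuous_const continuous_norm).inter
      (isClosed_le continuous_norm continuous_const)
  have hsub : openAnnulus r₁ r₂ ⊆ closedAnnulus r₁ r₂ := fun z hz => ⟨hz.1.le, hz.2.le⟩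
  -- Averages over rotations are taken of a continuous extension of `f` to the plane.
  obtain ⟨F, hF⟩ := ContinuousMap.exists_restrict_eq hclosed ⟨_, hfc.domRestrict⟩
  have hFf : ∀ z ∈ closedAnnulus r₁ r₂, F z = f z := fun z hz =>
    congrArg (fun g : C(closedAnnulus r₁ r₂, ℂ) => g ⟨z, hz⟩) hF
  have hzero : HasZeroCircleAverages F r₁ r₂ := by
    intro a ρ h1 h2
    have ha : ‖a‖ < ρ := by linarith
    have hρ : 0 < ρ := (norm_nonneg a).trans_lt ha
    have hs := (sphere_subset_openAnnulus hρ.le h1 h2).trans hsub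
    rw [← hmean a ρ hs (by simpa [CircleSurroundsOrigin] using ha)]
    refine Real.circleAverage_congr_sphere fun z hz => ?_
    rw [abs_of_pos hρ] at hz
    exact hFf z (hs hz)
  have hHolder : ∀ x ∈ openAnnulus r₁ r₂, ∀ y ∈ openAnnulus r₁ r₂,
      ‖F x - F y‖ ≤ (C : ℝ) * ‖x - y‖ ^ (α : ℝ) := by
    intro x hx y hy
    rw [hFf x (hsub hx), hFf y (hsub hy), ← dist_eq_norm, ← dist_eq_norm]
    exact hold.dist_le (hsub hx) (hsub hy)
  have hα' : (0 : ℝ) < α := by exact_mod_cast hα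
  have hα1' : (α : ℝ) ≤ 1 := by exact_mod_cast hα1
  obtain ⟨u, hu, huH, huF⟩ := exists_decomposable_tendstoUniformlyOn F.continuous hr₁ hzero
    C.coe_nonneg hα' hHolder
  choose G hG H hH hdec using hu
  obtain ⟨Gp, hGp, hGlim⟩ := exists_isBoundedContHolo_tendsto_of_isDecomposable hr₁ hr₂ hG hH hdec
    C.coe_nonneg hα' hα1' huH huF
  have hconj : ∀ z ∈ openAnnulus r₁ r₂, conj z ∈ openAnnulus r₁ r₂ := fun z hz => by
    simpa [openAnnulus] using hz
  -- The other part of the decomposition belongs to `z ↦ f z̄`.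
  obtain ⟨Gm, hGm, hHlim⟩ := exists_isBoundedContHolo_tendsto_of_isDecomposable hr₁ hr₂ hH hG
    (fun n => (hdec n).comp_conj) C.coe_nonneg hα' hα1'
    (fun n x hx y hy => by
      have := huH n _ (hconj x hx) _ (hconj y hy)
      rwa [← map_sub, RCLike.norm_conj] at this)
    ((huF.comp (starRingEnd ℂ)).mono hconj)
  refine ⟨Gp, fun p => Gm p.swap, hGp, ?_, ?_⟩
  · rw [omegaMinus_eq_preimage_swap hr₁ hr₂]
    exact hGm.comp_swap
  have hmemc : ∀ z ∈ closedAnnulus r₁ r₂, conj z ∈ closedAnnulus r₁ r₂ := fun z hz => by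
    simpa [closedAnnulus] using hz
  have hcl : ∀ z ∈ closedAnnulus r₁ r₂,
      (conj z, z) ∈ closure (omegaPlus (closedAnnulus r₁ r₂)) := fun z hz => by
    simpa using mem_closure_omegaPlus hr₁ hr₁₂ (hmemc z hz)
  have hne : ∀ z ∈ closedAnnulus r₁ r₂, z ≠ 0 := fun z hz => norm_pos_iff.1 (hr₁.trans_le hz.1)
  have hcc := Complex.continuous_conj.continuousOn (s := closedAnnulus r₁ r₂)
  refine Set.EqOn.of_subset_closure (s := openAnnulus r₁ r₂) ?_ hfc ?_ hsub
    (closedAnnulus_subset_closure hr₁ hr₁₂)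
  · intro z hz
    have h1 := ((hGlim _ (mem_closure_omegaPlus hr₁ hr₁₂ (hsub hz))).const_mul (conj z)⁻¹).add
      ((hHlim _ (hcl z (hsub hz))).const_mul z⁻¹)
    have h2 := huF.tendsto_at hz
    simp only [hdec _ z hz] at h2
    rw [← hFf z (hsub hz), tendsto_nhds_unique h2 h1]
    simp
  · refine ContinuousOn.add (ContinuousOn.mul ?_ ?_) (ContinuousOn.mul ?_ ?_)
    · exact continuousOn_const.div hcc fun z hz => by simpa using hne z hz
    · exact hGp.1.comp (continuousOn_id.prodMk hcc) fun z hz => mem_closure_omegaPlus hr₁ hr₁₂ hz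
    · exact continuousOn_const.div continuousOn_id hne
    · exact hGm.1.comp (hcc.prodMk continuousOn_id) fun z hz => hcl z hz
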